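/- Hypergraphs are finite and may have parallel edges: a hypergraph $H=(V,E)$ consists of finite sets $V$ (vertices) and $E$ (edges) together with an incidence function assigning to each edge a subset of $V$; $H$ is $k$-uniform if every edge has exactly $k$ vertices. A walk $v_0e_1v_1\dots e_sv_s$ in $H$ satisfies $v_{i-1}\neq v_i$ and $v_{i-1},v_i\in e_i$ for every $i$; its anchors are $v_0,\dots,v_s$, its anchor flags are the pairs $(v_{i-1},e_i)$ and $(v_i,e_i)$, and it is a strict trail if $e_1,\dots,e_s$ are pairwise distinct. An Euler family of $H$ is a collection of pairwise edge-disjoint and pairwise anchor-disjoint closed strict trails of positive length that together traverse every edge of $H$; $H$ is quasi-eulerian if it has an Euler family. Write $c(\cdot)$ for the number of connected components; an edge $e$ is a cut edge of $H$ if $c(H\setminus e)>c(H)$, where $H\setminus e$ has the same vertex set as $H$. Let $k\ge 4$ and let $H=(V,E)$ be a $k$-uniform hypergraph with $n$ vertices and $m$ edges and without cut edges. Let $G$ be its incidence graph: its vertices are the elements of $V$ (v-vertices) and of $E$ (e-vertices), and a v-vertex $v$ and an e-vertex $e$ are joined by one edge exactly when $v\in e$. Put $r=(m+n)^2$, and let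 $G^*$ be the multigraph obtained from $G$ by appending $2r$ loops to every v-vertex. Define $f:V(G^*)\to\mathbb{N}$ by $f(x)=2$ if $x$ is an e-vertex and $f(x)=2r$ if $x$ is a v-vertex. An $(f,f)$-factor of $G^*$ is a spanning subgraph $F$ of $G^*$ with $\deg_F(x)=f(x)$ for every vertex $x$, where each loop contributes $2$ to the degree. Suppose that every $X\subseteq E$ with $|X|\ge 2$ satisfies $$|X|\;\ge\; 2\left\lfloor \frac{c(G^*-X)+3}{k}\right\rfloor .$$ Then $G^*$ has an $(f,f)$-factor. Furthermore, every $(f,f)$-factor $F$ of $G^*$ yields an Euler family of $H$ whose anchor flags are exactly the pairs $(v,e)$ for which $ve$ is an edge of $F$. Hence $H$ is quasi-eulerian. -/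

import Mathlib

/-! ### Multigraphs: degree, components, factors, attaching loops -/

namespace Graph

/-- The degree of a vertex of a multigraph: the number of incident edges, each loop counting
twice. -/
noncomputable def degree {α β : Type*} (G : Graph α β) (x : α) : ℕ :=
  (G.incidenceSet x).ncard + (G.loopSet x).ncard

/-- The simple graph on the vertices of `G` in which distinct vertices are adjacent exactly when
some edge of `G` joins them; it has the same connected components as `G`. -/
def underlying {α β : Type*} (G : Graph α β) : SimpleGraph G.vertexSet where
  Adj x y := x ≠ y ∧ G.Adj (x : α) (y : α)
  symm := ⟨fun _ _ h => ⟨h.1.symm, h.2.symm⟩⟩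
  loopless := ⟨fun _ h => h.1 rfl⟩

/-- The number `c(G)` of connected components of `G`. -/
noncomputable def numComponents {α β : Type*} (G : Graph α β) : ℕ :=
  Nat.card G.underlying.ConnectedComponent

/-- `F` is a `(g, f)`-factor of `G`: a spanning subgraph with `g x ≤ deg_F(x) ≤ f x` at every
vertex `x`. -/
def IsFactor {α β : Type*} (G : Graph α β) (g f : α → ℕ) (F : Graph α β) : Prop :=
  F.IsSpanningSubgraph G ∧ ∀ x ∈ G.vertexSet, g x ≤ F.degree x ∧ F.degree x ≤ f x

/-- The multigraph obtained from `G` by appending `N` new loops to every vertex in `S`.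
The edge `Sum.inl b` is the old edge `b`; the edges `Sum.inr (s, i)` are the new loops at `s`. -/
def appendLoops {α β : Type*} (G : Graph α β) (S : Set α) (N : ℕ) :
    Graph α (β ⊕ α × Fin N) where
  vertexSet := G.vertexSet
  IsLink e x y := match e with
    | Sum.inl b => G.IsLink b x y
    | Sum.inr p => p.1 ∈ G.vertexSet ∧ p.1 ∈ S ∧ x = p.1 ∧ y = p.1
  isLink_symm := by
    rintro (b | p) _ <;> refine ⟨fun x y h => ?_⟩
    · exact Graph.IsLink.symm h
    · exact ⟨h.1, h.2.1, h.2.2.2, h.2.2.1⟩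
  eq_or_eq_of_isLink_of_isLink := by
    rintro (b | p) x y v w h h'
    · exact Graph.IsLink.left_eq_or_eq h h'
    · exact Or.inl (h.2.2.1.trans h'.2.2.1.symm)
  left_mem_of_isLink := by
    rintro (b | p) x y h
    · exact Graph.IsLink.left_mem h
    · exact h.2.2.1 ▸ h.1

end Graph

/-! ### Hypergraphs with parallel edges allowed -/

/-- A hypergraph with vertex set `V` and edge set `E`, given by its incidence function.
Distinct edges may have the same set of vertices. -/
structure MultiHypergraph (V E : Type*) where
  /-- The set of vertices of an edge. -/
  inc : E → Finset V

namespace MultiHypergraph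

/-- Every edge has exactly `k` vertices. -/
def IsUniform {V E : Type*} (H : MultiHypergraph V E) (k : ℕ) : Prop :=
  ∀ e, (H.inc e).card = k

/-- Walks `v₀ e₁ v₁ … eₘ vₘ` in a hypergraph: consecutive anchors are distinct and both lie in the
edge listed between them. -/
inductive Walk {V E : Type*} (H : MultiHypergraph V E) : V → V → Type _
  | nil (v : V) : Walk H v v
  | cons {u v w : V} (e : E) (hne : u ≠ v) (hu : u ∈ H.inc e) (hv : v ∈ H.inc e)
      (p : Walk H v w) : Walk H u w

namespace Walk

/-- The anchors `v₀, …, vₘ` of a walk. -/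
def anchors {V E : Type*} {H : MultiHypergraph V E} {u v : V} : H.Walk u v → List V
  | nil v => [v]
  | @cons _ _ _ u _ _ _ _ _ _ p => u :: p.anchors

/-- The edges `e₁, …, eₘ` of a walk. -/
def edges {V E : Type*} {H : MultiHypergraph V E} {u v : V} : H.Walk u v → List E
  | nil _ => []
  | cons e _ _ _ p => e :: p.edges

/-- The anchor flags `(vᵢ₋₁, eᵢ)` and `(vᵢ, eᵢ)` of a walk. -/
def anchorFlags {V E : Type*} {H : MultiHypergraph V E} {u v : V} : H.Walk u v → List (V × E)
  | nil _ => []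
  | @cons _ _ _ u v _ e _ _ _ p => (u, e) :: (v, e) :: p.anchorFlags

/-- A strict trail is a walk with pairwise distinct edges. -/
def IsStrictTrail {V E : Type*} {H : MultiHypergraph V E} {u v : V} (p : H.Walk u v) : Prop :=
  p.edges.Nodup

/-- A walk is non-trivial if it has positive length. -/
def IsNontrivial {V E : Type*} {H : MultiHypergraph V E} {u v : V} (p : H.Walk u v) : Prop :=
  p.edges ≠ []

end Walk

/-- The number `c(H)` of connected components of `H`, that is, of classes of vertices joined by
walks. -/
noncomputable def numComponents {V E : Type*} (H : MultiHypergraph V E) : ℕ :=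
  Nat.card (Quot fun u v : V => Nonempty (H.Walk u v))

/-- The edge-deleted subhypergraph `H \ e`. -/
def deleteEdge {V E : Type*} (H : MultiHypergraph V E) (e : E) :
    MultiHypergraph V {f : E // f ≠ e} where
  inc f := H.inc f.1

/-- `e` is a cut edge if deleting it increases the number of connected components. -/
def IsCutEdge {V E : Type*} (H : MultiHypergraph V E) (e : E) : Prop :=
  H.numComponents < (H.deleteEdge e).numComponents

/-- An Euler family: a collection of pairwise edge-disjoint and anchor-disjoint non-trivial closed
strict trails that together traverse every edge. -/
structure IsEulerFamily {V E : Type*} (H : MultiHypergraph V E)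
    (𝓕 : Set (Σ v : V, H.Walk v v)) : Prop where
  strictTrail : ∀ T ∈ 𝓕, T.2.IsStrictTrail
  nontrivial : ∀ T ∈ 𝓕, T.2.IsNontrivial
  edgeDisjoint : ∀ T ∈ 𝓕, ∀ T' ∈ 𝓕, T ≠ T' → ∀ e ∈ T.2.edges, e ∉ T'.2.edges
  anchorDisjoint : ∀ T ∈ 𝓕, ∀ T' ∈ 𝓕, T ≠ T' → ∀ v ∈ T.2.anchors, v ∉ T'.2.anchors
  traverses : ∀ e : E, ∃ T ∈ 𝓕, e ∈ T.2.edges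

/-- A hypergraph is quasi-eulerian if it admits an Euler family. -/
def IsQuasiEulerian {V E : Type*} (H : MultiHypergraph V E) : Prop :=
  ∃ 𝓕 : Set (Σ v : V, H.Walk v v), H.IsEulerFamily 𝓕

/-- The flags of `H`: pairs of a vertex and an edge containing it. -/
abbrev Flag {V E : Type*} (H : MultiHypergraph V E) : Type _ :=
  {p : V × E // p.1 ∈ H.inc p.2}

/-- The incidence graph of `H`. Its vertices are the v-vertices `Sum.inl v` and the e-vertices
`Sum.inr e`; its edges are the flags of `H`, the flag `(v, e)` joining `v` and `e`. -/
def incidenceGraph {V E : Type*} (H : MultiHypergraph V E) : Graph (V ⊕ E) H.Flag where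
  vertexSet := Set.univ
  IsLink p x y := (x = Sum.inl p.1.1 ∧ y = Sum.inr p.1.2) ∨ (x = Sum.inr p.1.2 ∧ y = Sum.inl p.1.1)
  isLink_symm := by
    rintro p _
    refine ⟨fun x y h => ?_⟩
    rcases h with h | h
    · exact Or.inr ⟨h.2, h.1⟩
    · exact Or.inl ⟨h.2, h.1⟩
  eq_or_eq_of_isLink_of_isLink := by
    rintro p x y v w (⟨rfl, rfl⟩ | ⟨rfl, rfl⟩) (⟨rfl, rfl⟩ | ⟨rfl, rfl⟩) <;> simp
  left_mem_of_isLink := fun _ _ _ _ => Set.mem_univ _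

end MultiHypergraph

/-! An `(f,f)`-factor amounts to a set of flags with two flags of every edge and evenly many at
every vertex (`IsEvenSelection`): loops only pad the degree of a v-vertex in steps of two. A perfect
matching of `flagGraph` yields such a set: the `k - 2` inner vertices of an edge consume all but two
of its flags, and the remaining flags are paired at their common vertices.

Without a perfect matching, Tutte's theorem gives a barrier `U`. If `U` has minimum size, each of
its vertices sees at least three odd sets, and the local structure of `flagGraph` then describes `U`
by two disjoint edge sets: all flags of `A`, all inner vertices of `T`, up to inner vertices of `A`
(`exists_isCleanFamily`). A count and a parity argument leave more than `2|A| + (k-2)|T|` odd sets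
that contain a flag of an edge of `T` (`card_lt_of_bound`), whence `|A| < |T|`. Flags chosen from
distinct such sets lie in distinct components of `G* - (A ∪ T)`. If `|A ∪ T| = 1` this contradicts
the absence of cut edges, and otherwise the hypothesis on `c(G* - X)`, by `barrier_arithmetic`.

Given a factor, each edge with its two chosen flags acts as an ordinary edge between two vertices.
The resulting multigraph is even, and Hierholzer's argument gives one Euler circuit per nontrivial
component (`exists_trail_decomposition`). -/

set_option linter.unusedSectionVars false

/-! ### Tutte barriers and a minimum barrier -/

namespace SimpleGraph

/-- `𝒞` is a family of pairwise disjoint odd sets of vertices outside `U`, each of them a union of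
connected components of the graph obtained by deleting `U`. -/
structure IsOddFamily {W : Type*} (G : SimpleGraph W) (U : Finset W)
    (𝒞 : Finset (Finset W)) : Prop where
  disj : ∀ C ∈ 𝒞, ∀ D ∈ 𝒞, ∀ x, x ∈ C → x ∈ D → C = D
  odd : ∀ C ∈ 𝒞, Odd C.card
  notMem : ∀ C ∈ 𝒞, ∀ x ∈ C, x ∉ U
  closed : ∀ C ∈ 𝒞, ∀ x ∈ C, ∀ y, G.Adj x y → y ∉ U → y ∈ C

/-- This is Tutte's theorem, with the odd components moved from the deleted graph to vertex sets of
`G`, so that `U` can be changed later without changing the ambient type. -/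
theorem exists_isOddFamily_of_forall_not_isPerfectMatching {W : Type*} [Fintype W] [DecidableEq W]
    (G : SimpleGraph W) (h : ∀ M : G.Subgraph, ¬ M.IsPerfectMatching) :
    ∃ U 𝒞, G.IsOddFamily U 𝒞 ∧ U.card < 𝒞.card := by
  classical
  have h1 : ¬ ∀ u, ¬ G.IsTutteViolator u := fun h2 => by
    obtain ⟨M, hM⟩ := SimpleGraph.tutte.2 h2
    exact h M hM
  push Not at h1
  obtain ⟨u, hu⟩ := h1
  unfold IsTutteViolator at hu
  set K := ((⊤ : G.Subgraph).deleteVerts u).coe with hK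
  let supp : K.ConnectedComponent → Finset W := fun c =>
    (Set.toFinite (Subtype.val '' c.supp)).toFinset
  have hmem : ∀ c x, x ∈ supp c ↔ ∃ hx : x ∈ ((⊤ : G.Subgraph).deleteVerts u).verts,
      K.connectedComponentMk ⟨x, hx⟩ = c := by
    intro c x
    simp [supp]
  have hdis : ∀ c d x, x ∈ supp c → x ∈ supp d → c = d := by
    intro c d x hc hd
    obtain ⟨_, rfl⟩ := (hmem _ _).1 hc
    obtain ⟨_, rfl⟩ := (hmem _ _).1 hd
    rfl
  have hne : ∀ c, ∃ x, x ∈ supp c := by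
    intro c
    obtain ⟨⟨x, hx⟩, rfl⟩ := c.exists_rep
    exact ⟨x, (hmem _ _).2 ⟨hx, rfl⟩⟩
  have hinj : Function.Injective supp := by
    intro c d hcd
    obtain ⟨x, hx⟩ := hne c
    exact hdis c d x hx (hcd ▸ hx)
  refine ⟨(Set.toFinite u).toFinset, (Set.toFinite K.oddComponents).toFinset.image supp,
    ⟨?_, ?_, ?_, ?_⟩, ?_⟩
  · intro C hC D hD x hx hx'
    obtain ⟨c, -, rfl⟩ := Finset.mem_image.1 hC
    obtain ⟨d, -, rfl⟩ := Finset.mem_image.1 hD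
    rw [hdis c d x hx hx']
  · intro C hC
    obtain ⟨c, hc, rfl⟩ := Finset.mem_image.1 hC
    have hc' : Odd c.supp.ncard := by simpa using hc
    have : (supp c).card = c.supp.ncard := by
      rw [← Set.ncard_eq_toFinset_card, Set.ncard_image_of_injective _ Subtype.val_injective]
    rwa [this]
  · intro C hC x hx
    obtain ⟨c, -, rfl⟩ := Finset.mem_image.1 hC
    obtain ⟨hx, -⟩ := (hmem _ _).1 hx
    simpa using hx
  · intro C hC x hx y hxy hy
    obtain ⟨c, -, rfl⟩ := Finset.mem_image.1 hC
    obtain ⟨hx, rfl⟩ := (hmem _ _).1 hx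
    have hy' : y ∈ ((⊤ : G.Subgraph).deleteVerts u).verts := by simpa using hy
    refine (hmem _ _).2 ⟨hy', ?_⟩
    refine (ConnectedComponent.connectedComponentMk_eq_of_adj ?_).symm
    simp only [hK, Subgraph.coe_adj, Subgraph.deleteVerts_adj, Subgraph.top_adj]
    simp_all
  · rw [Finset.card_image_of_injective _ hinj, ← Set.ncard_eq_toFinset_card,
      ← Set.ncard_eq_toFinset_card]
    exact hu

/-- If the surplus is exactly one, parity makes the set of uncovered vertices odd. It may join the
family as a single member, because members need only be unions of components. -/
theorem IsOddFamily.exists_add_two_le {W : Type*} [Fintype W] [DecidableEq W] {G : SimpleGraph W}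
    (hW : Even (Fintype.card W)) {U : Finset W} {𝒞 : Finset (Finset W)} (h : G.IsOddFamily U 𝒞)
    (hlt : U.card < 𝒞.card) : ∃ 𝒟, G.IsOddFamily U 𝒟 ∧ U.card + 2 ≤ 𝒟.card := by
  by_cases h2 : U.card + 2 ≤ 𝒞.card
  · exact ⟨𝒞, h, h2⟩
  have hc : 𝒞.card = U.card + 1 := by omega
  have hB : Disjoint U (𝒞.biUnion id) := by
    rw [Finset.disjoint_right]
    intro x hx
    obtain ⟨C, hC, hx⟩ := Finset.mem_biUnion.1 hx
    exact h.notMem C hC x hx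
  have hBcard : (𝒞.biUnion id).card = ∑ C ∈ 𝒞, C.card := by
    refine Finset.card_biUnion fun C hC D hD hCD => ?_
    rw [Function.onFun, Finset.disjoint_left]
    exact fun x hx hx' => hCD (h.disj C hC D hD x hx hx')
  have hpar : Odd (∑ C ∈ 𝒞, C.card) ↔ Odd 𝒞.card := by
    rw [Finset.odd_sum_iff_odd_card_odd, Finset.filter_true_of_mem h.odd]
  set R := (U ∪ 𝒞.biUnion id)ᶜ with hR
  have hRcard : R.card + (U.card + ∑ C ∈ 𝒞, C.card) = Fintype.card W := by
    rw [← hBcard, ← Finset.card_union_of_disjoint hB, hR, Finset.card_compl_add_card]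
  have hRodd : Odd R.card := by
    rw [hc] at hpar
    grind
  have hRmem : ∀ x, x ∈ R ↔ x ∉ U ∧ ∀ C ∈ 𝒞, x ∉ C := by
    intro x
    simp [hR]
  have hRne : R.Nonempty := Finset.card_pos.1 hRodd.pos
  have hRnot : R ∉ 𝒞 := by
    intro hR'
    obtain ⟨x, hx⟩ := hRne
    exact ((hRmem x).1 hx).2 R hR' hx
  refine ⟨insert R 𝒞, ⟨?_, ?_, ?_, ?_⟩, ?_⟩
  · intro C hC D hD x hx hx'
    rcases Finset.mem_insert.1 hC with rfl | hC <;> rcases Finset.mem_insert.1 hD with rfl | hD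
    · rfl
    · exact absurd hx' (((hRmem x).1 hx).2 D hD)
    · exact absurd hx (((hRmem x).1 hx').2 C hC)
    · exact h.disj C hC D hD x hx hx'
  · intro C hC
    rcases Finset.mem_insert.1 hC with rfl | hC
    exacts [hRodd, h.odd C hC]
  · intro C hC x hx
    rcases Finset.mem_insert.1 hC with rfl | hC
    exacts [((hRmem x).1 hx).1, h.notMem C hC x hx]
  · intro C hC x hx y hxy hy
    rcases Finset.mem_insert.1 hC with rfl | hC
    · rw [hRmem] at hx ⊢
      exact ⟨hy, fun C hC hyC => hx.2 C hC (h.closed C hC y hyC x hxy.symm hx.1)⟩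
    · exact h.closed C hC x hx y hxy hy
  · rw [Finset.card_insert_of_notMem hRnot]
    omega

/-- If a graph of even order has no perfect matching, then it has a Tutte barrier every vertex of
which is adjacent to at least three of the odd sets. -/
theorem exists_isOddFamily_forall_two_lt {W : Type*} [Fintype W] [DecidableEq W]
    (G : SimpleGraph W) (hW : Even (Fintype.card W))
    (h : ∀ M : G.Subgraph, ¬ M.IsPerfectMatching) :
    ∃ U 𝒞, G.IsOddFamily U 𝒞 ∧ U.card < 𝒞.card ∧
      ∀ u ∈ U, ∀ 𝒟 ⊆ 𝒞, 𝒟.card ≤ 2 → ∃ C ∈ 𝒞, C ∉ 𝒟 ∧ ∃ x ∈ C, G.Adj u x := by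
  classical
  have hex : ∃ n, ∃ U 𝒞, G.IsOddFamily U 𝒞 ∧ U.card < 𝒞.card ∧ U.card = n := by
    obtain ⟨U, 𝒞, h1, h2⟩ := exists_isOddFamily_of_forall_not_isPerfectMatching G h
    exact ⟨_, U, 𝒞, h1, h2, rfl⟩
  obtain ⟨U, 𝒞₀, hU, hlt, hn⟩ := Nat.find_spec hex
  have hmin := fun m hm => Nat.find_min hex (m := m) hm
  rw [← hn] at hmin
  -- The surplus of two pays for dropping two members together with one barrier vertex: `|𝒞| - 2 >
  -- |U| - 1`.
  obtain ⟨𝒞, h𝒞, hle⟩ := hU.exists_add_two_le hW hlt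
  refine ⟨U, 𝒞, h𝒞, by omega, ?_⟩
  intro u hu 𝒟 h𝒟 h𝒟card
  by_contra hcon
  push Not at hcon
  have hpos : 0 < U.card := Finset.card_pos.2 ⟨u, hu⟩
  have hcard : (U.erase u).card = U.card - 1 := Finset.card_erase_of_mem hu
  -- The vertex `u` has no neighbour in the members that are kept, so these stay closed when `u`
  -- leaves the barrier, against the minimality of `U`.
  refine hmin (U.card - 1) (by omega) ⟨U.erase u, 𝒞 \ 𝒟, ⟨?_, ?_, ?_, ?_⟩, ?_, hcard⟩
  · exact fun C hC D hD => h𝒞.disj C (Finset.mem_sdiff.1 hC).1 D (Finset.mem_sdiff.1 hD).1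
  · exact fun C hC => h𝒞.odd C (Finset.mem_sdiff.1 hC).1
  · exact fun C hC x hx hxU =>
      h𝒞.notMem C (Finset.mem_sdiff.1 hC).1 x hx (Finset.mem_of_mem_erase hxU)
  · intro C hC x hx y hxy hy
    obtain ⟨hC, hCD⟩ := Finset.mem_sdiff.1 hC
    refine h𝒞.closed C hC x hx y hxy fun hyU => hy (Finset.mem_erase.2 ⟨?_, hyU⟩)
    rintro rfl
    exact hcon C hC hCD x hx hxy.symm
  · have := Finset.card_sdiff_add_card_eq_card h𝒟
    omega

end SimpleGraph

/-! ### Cut edges and the auxiliary flag graph -/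

namespace MultiHypergraph

/-- A property of vertices that is constant on every edge other than `e` is constant on `e`,
unless `e` is a cut edge. -/
theorem iff_of_not_isCutEdge {V E : Type*} [Finite V] {H : MultiHypergraph V E} {e : E}
    (he : ¬ H.IsCutEdge e) {R : V → Prop}
    (hR : ∀ f, f ≠ e → ∀ x ∈ H.inc f, ∀ y ∈ H.inc f, R x → R y)
    {u w : V} (hu : u ∈ H.inc e) (hw : w ∈ H.inc e) : R u ↔ R w := by
  have hwalk : ∀ x y, (H.deleteEdge e).Walk x y → (R x ↔ R y) := by
    intro x y p
    induction p with
    | nil v => exact Iff.rfl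
    | cons f hne hx hy p ih =>
      exact Iff.trans ⟨hR f.1 f.2 _ hx _ hy, hR f.1 f.2 _ hy _ hx⟩ ih
  have hlift : ∀ x y, (H.deleteEdge e).Walk x y → Nonempty (H.Walk x y) := by
    intro x y p
    induction p with
    | nil v => exact ⟨.nil v⟩
    | cons f hne hx hy p ih => exact ⟨.cons f.1 hne hx hy ih.some⟩
  let φ : Quot (fun u v : V => Nonempty ((H.deleteEdge e).Walk u v)) →
      Quot (fun u v : V => Nonempty (H.Walk u v)) :=
    Quot.map id fun x y ⟨p⟩ => hlift x y p
  have hφ : Function.Surjective φ := by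
    intro q
    obtain ⟨x, rfl⟩ := Quot.exists_rep q
    exact ⟨Quot.mk _ x, rfl⟩
  -- A surjection between finite sets whose target is not smaller is injective: deleting `e`
  -- separates no vertices.
  have hinj : Function.Injective φ := by
    refine ((Nat.bijective_iff_surjective_and_card φ).2 ⟨hφ, ?_⟩).1
    exact le_antisymm (not_lt.1 he) (Nat.card_le_card_of_surjective φ hφ)
  have hq : φ (Quot.mk _ u) = φ (Quot.mk _ w) := by
    by_cases huw : u = w
    · rw [huw]
    · exact Quot.sound ⟨.cons e huw hu hw (.nil w)⟩
  have hgen : ∀ x y, Relation.EqvGen (fun u v : V => Nonempty ((H.deleteEdge e).Walk u v)) x y →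
      (R x ↔ R y) := by
    intro x y h
    induction h with
    | rel x y h => exact hwalk x y h.some
    | refl x => exact Iff.rfl
    | symm x y _ ih => exact ih.symm
    | trans x y z _ _ ih1 ih2 => exact ih1.trans ih2
  exact hgen u w (Quot.eqvGen_exact (hinj hq))

/-- The auxiliary graph on the flags of `H` and `k - 2` further vertices for each edge of `H`: two
flags are adjacent if they have the same vertex, and the further vertices of an edge are adjacent
to the flags of that edge. -/
def flagGraph {V E : Type*} (H : MultiHypergraph V E) (k : ℕ) :
    SimpleGraph (H.Flag ⊕ E × Fin (k - 2)) where
  Adj x y := match x, y with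
    | Sum.inl a, Sum.inl b => a ≠ b ∧ a.1.1 = b.1.1
    | Sum.inl a, Sum.inr p => a.1.2 = p.1
    | Sum.inr p, Sum.inl a => a.1.2 = p.1
    | Sum.inr _, Sum.inr _ => False
  symm := ⟨by
    rintro (a | p) (b | q) h
    · exact ⟨h.1.symm, h.2.symm⟩
    · exact h
    · exact h
    · exact h⟩
  loopless := ⟨by
    rintro (a | p) h
    · exact h.1 rfl
    · exact h⟩

section Fintype

variable {V E : Type*} [Fintype V] [Fintype E] [DecidableEq V] [DecidableEq E]
  {H : MultiHypergraph V E} {k : ℕ}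

theorem card_flags_of_edge (H : MultiHypergraph V E) (e : E) :
    (Finset.univ.filter fun a : H.Flag => a.1.2 = e).card = (H.inc e).card := by
  refine Finset.card_bij (fun a _ => a.1.1) ?_ ?_ ?_
  · intro a ha
    have := a.2
    rwa [(Finset.mem_filter.1 ha).2] at this
  · rintro ⟨⟨v, e'⟩, ha'⟩ ha ⟨⟨w, e''⟩, hb'⟩ hb hab
    simp_all
  · intro v hv
    exact ⟨⟨(v, e), hv⟩, by simp, rfl⟩

theorem card_flags_of_edges (hunif : H.IsUniform k) (A : Finset E) :
    (Finset.univ.filter fun a : H.Flag => a.1.2 ∈ A).card = A.card * k := by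
  rw [Finset.card_eq_sum_card_fiberwise (f := fun a : H.Flag => a.1.2) (t := A)
    (fun a ha => by simpa using ha)]
  refine Finset.sum_const_nat fun e he => ?_
  rw [Finset.filter_filter, ← hunif e, ← card_flags_of_edge H e]
  congr 1
  ext a
  simp only [Finset.mem_filter, Finset.mem_univ, true_and]
  exact ⟨fun h => h.2, fun h => ⟨h ▸ he, h⟩⟩

theorem even_card_flagGraph (hk : 2 ≤ k) (hunif : H.IsUniform k) :
    Even (Fintype.card (H.Flag ⊕ E × Fin (k - 2))) := by
  have h1 : Fintype.card H.Flag = Fintype.card E * k := by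
    have := card_flags_of_edges hunif Finset.univ
    simpa using this
  rw [Fintype.card_sum, h1, Fintype.card_prod, Fintype.card_fin, ← mul_add]
  exact Even.mul_left ⟨k - 1, by omega⟩ _

/-- The edge of `H` underlying a vertex of the auxiliary graph. -/
def flagGraphEdge (H : MultiHypergraph V E) (k : ℕ) : H.Flag ⊕ E × Fin (k - 2) → E :=
  Sum.elim (fun a => a.1.2) (fun p => p.1)

theorem even_card_flagGraphEdge_fiber (hk : 2 ≤ k) (hunif : H.IsUniform k) (e : E) :
    Even (Finset.univ.filter fun x => flagGraphEdge H k x = e).card := by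
  have : (Finset.univ.filter fun x => flagGraphEdge H k x = e) =
      (Finset.univ.filter fun a : H.Flag => a.1.2 = e).disjSum
        ({e} ×ˢ (Finset.univ : Finset (Fin (k - 2)))) := by
    ext x
    rw [Finset.mem_filter]
    rcases x with a | ⟨f, i⟩ <;> simp [flagGraphEdge, eq_comm]
  rw [this, Finset.card_disjSum, card_flags_of_edge, hunif e, Finset.card_product]
  simp only [Finset.card_singleton, one_mul, Finset.card_univ, Fintype.card_fin]
  exact ⟨k - 1, by omega⟩

end Fintype

end MultiHypergraph

/-! ### Structure of a minimum barrier and the contradiction -/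

namespace MultiHypergraph

section Barrier

variable {V E : Type*} [Fintype V] [Fintype E] [DecidableEq V] [DecidableEq E]
  {H : MultiHypergraph V E} {k : ℕ} {U : Finset (H.Flag ⊕ E × Fin (k - 2))}
  {𝒞 : Finset (Finset (H.Flag ⊕ E × Fin (k - 2)))}

theorem card_le_one_of_common_vertex (h : (H.flagGraph k).IsOddFamily U 𝒞)
    (x : H.Flag ⊕ E × Fin (k - 2)) : (𝒞.filter (x ∈ ·)).card ≤ 1 := by
  refine Finset.card_le_one.2 fun C hC D hD => ?_
  rw [Finset.mem_filter] at hC hD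
  exact h.disj C hC.1 D hD.1 x hC.2 hD.2

/-- Inner vertices of `e` have the same neighbours. If `(e, j)` is outside `U`, every odd set seen
by `(e, i)` also contains `(e, j)`, so there is at most one. -/
theorem inner_mem_of_inner_mem (h : (H.flagGraph k).IsOddFamily U 𝒞)
    (hU : ∀ u ∈ U, ∀ 𝒟 ⊆ 𝒞, 𝒟.card ≤ 2 → ∃ C ∈ 𝒞, C ∉ 𝒟 ∧ ∃ x ∈ C, (H.flagGraph k).Adj u x)
    (e : E) (i j : Fin (k - 2)) (hi : Sum.inr (e, i) ∈ U) : Sum.inr (e, j) ∈ U := by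
  by_contra hj
  obtain ⟨C, hC, hCD, x, hx, hadj⟩ := hU _ hi (𝒞.filter (Sum.inr (e, j) ∈ ·))
    (Finset.filter_subset _ _) ((card_le_one_of_common_vertex h _).trans one_le_two)
  refine hCD (Finset.mem_filter.2 ⟨hC, ?_⟩)
  rcases x with a | p
  · exact h.closed C hC _ hx _ hadj hj
  · exact hadj.elim

/-- The flag `a` sees odd sets in two ways. The flags at its vertex form a clique and meet at most
one; the inner vertices of its edge are all adjacent to `b`, so if `b` is outside `U` they meet at
most one more. -/
theorem flag_mem_of_flag_mem (h : (H.flagGraph k).IsOddFamily U 𝒞)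
    (hU : ∀ u ∈ U, ∀ 𝒟 ⊆ 𝒞, 𝒟.card ≤ 2 → ∃ C ∈ 𝒞, C ∉ 𝒟 ∧ ∃ x ∈ C, (H.flagGraph k).Adj u x)
    (a b : H.Flag) (hab : a.1.2 = b.1.2) (ha : Sum.inl a ∈ U) : Sum.inl b ∈ U := by
  classical
  by_contra hb
  obtain ⟨C, hC, hCD, x, hx, hadj⟩ := hU _ ha
    (𝒞.filter (Sum.inl b ∈ ·) ∪ 𝒞.filter fun C => ∃ c : H.Flag, Sum.inl c ∈ C ∧ a.1.1 = c.1.1)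
    (Finset.union_subset (Finset.filter_subset _ _) (Finset.filter_subset _ _)) (by
      refine (Finset.card_union_le _ _).trans
        (add_le_add (card_le_one_of_common_vertex h _) (Finset.card_le_one.2 fun C hC D hD => ?_))
      obtain ⟨hC, c, hcC, hac⟩ := Finset.mem_filter.1 hC
      obtain ⟨hD, d, hdD, had⟩ := Finset.mem_filter.1 hD
      by_cases hcd : c = d
      · exact h.disj C hC D hD _ hcC (hcd ▸ hdD)
      · exact h.disj C hC D hD _
          (h.closed C hC _ hcC (Sum.inl d) ⟨hcd, hac.symm.trans had⟩ (h.notMem D hD _ hdD)) hdD)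
  rw [Finset.mem_union, Finset.mem_filter, Finset.mem_filter, not_or] at hCD
  rcases x with c | ⟨e, i⟩
  · exact hCD.2 ⟨hC, c, hx, hadj.2⟩
  · exact hCD.1 ⟨hC, h.closed C hC _ hx (Sum.inl b) (hab.symm.trans hadj) hb⟩

/-- An odd family relative to `U` whose barrier `U` consists of all flags of the edges in `A`, all
inner vertices of the edges in `T`, and possibly inner vertices of the edges in `A`. -/
structure IsCleanFamily (H : MultiHypergraph V E) (k : ℕ) (U : Finset (H.Flag ⊕ E × Fin (k - 2)))
    (𝒞 : Finset (Finset (H.Flag ⊕ E × Fin (k - 2)))) (A T : Finset E) : Prop where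
  fam : (H.flagGraph k).IsOddFamily U 𝒞
  disj : Disjoint A T
  flag_mem : ∀ a : H.Flag, Sum.inl a ∈ U ↔ a.1.2 ∈ A
  inner_mem : ∀ e ∈ T, ∀ i, Sum.inr (e, i) ∈ U
  inner_notMem : ∀ e, e ∉ A → e ∉ T → ∀ i, Sum.inr (e, i) ∉ U

theorem exists_isCleanFamily (hk : 3 ≤ k) (hunif : H.IsUniform k)
    (hno : ∀ M : (H.flagGraph k).Subgraph, ¬ M.IsPerfectMatching) :
    ∃ U 𝒞 A T, IsCleanFamily H k U 𝒞 A T ∧ U.card < 𝒞.card := by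
  classical
  obtain ⟨U, 𝒞, h, hlt, hU⟩ := (H.flagGraph k).exists_isOddFamily_forall_two_lt
    (even_card_flagGraph (by omega) hunif) hno
  -- `A` is the set of edges with all flags in the barrier, `T` the set of other edges with all
  -- inner vertices in it.
  refine ⟨U, 𝒞, Finset.univ.filter fun e => ∀ a : H.Flag, a.1.2 = e → Sum.inl a ∈ U,
    Finset.univ.filter fun e => (¬ ∀ a : H.Flag, a.1.2 = e → Sum.inl a ∈ U) ∧
      ∀ i, Sum.inr (e, i) ∈ U, ⟨h, ?_, ?_, ?_, ?_⟩, hlt⟩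
  · rw [Finset.disjoint_left]
    intro e he he'
    exact (Finset.mem_filter.1 he').2.1 (Finset.mem_filter.1 he).2
  · intro a
    rw [Finset.mem_filter]
    exact ⟨fun ha => ⟨Finset.mem_univ _, fun b hb => flag_mem_of_flag_mem h hU a b hb.symm ha⟩,
      fun ha => ha.2 a rfl⟩
  · exact fun e he => (Finset.mem_filter.1 he).2.2
  · intro e heA heT i hi
    rw [Finset.mem_filter] at heA heT
    exact heT ⟨Finset.mem_univ _, fun h' => heA ⟨Finset.mem_univ _, h'⟩,
      fun j => inner_mem_of_inner_mem h hU e i j hi⟩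

namespace IsCleanFamily

variable {A T : Finset E}

theorem card_barrier (h : IsCleanFamily H k U 𝒞 A T) (hunif : H.IsUniform k) :
    A.card * k + T.card * (k - 2) ≤ U.card := by
  have hsub : (Finset.univ.filter fun a : H.Flag => a.1.2 ∈ A).disjSum
      (T ×ˢ (Finset.univ : Finset (Fin (k - 2)))) ⊆ U := by
    intro x hx
    rcases x with a | ⟨e, i⟩
    · rw [Finset.inl_mem_disjSum, Finset.mem_filter] at hx
      exact (h.flag_mem a).2 hx.2
    · rw [Finset.inr_mem_disjSum, Finset.mem_product] at hx
      exact h.inner_mem e hx.1 i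
  have := Finset.card_le_card hsub
  rwa [Finset.card_disjSum, card_flags_of_edges hunif, Finset.card_product, Finset.card_univ,
    Fintype.card_fin] at this

/-- All flags of `v` outside the barrier belong to `C`. -/
def Full (U C : Finset (H.Flag ⊕ E × Fin (k - 2))) (v : V) : Prop :=
  ∀ a : H.Flag, a.1.1 = v → Sum.inl a ∉ U → Sum.inl a ∈ C

theorem full_of_mem (h : IsCleanFamily H k U 𝒞 A T) {C} (hC : C ∈ 𝒞) {a : H.Flag}
    (ha : Sum.inl a ∈ C) : Full U C a.1.1 := by
  intro b hb hbU
  by_cases hab : a = b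
  · exact hab ▸ ha
  · exact h.fam.closed C hC _ ha (Sum.inl b) ⟨hab, hb.symm⟩ hbU

theorem inner_mem_of_flag (h : IsCleanFamily H k U 𝒞 A T) {C} (hC : C ∈ 𝒞) {a : H.Flag}
    (ha : Sum.inl a ∈ C) (haT : a.1.2 ∉ T) (i : Fin (k - 2)) : Sum.inr (a.1.2, i) ∈ C := by
  refine h.fam.closed C hC _ ha (Sum.inr (a.1.2, i)) rfl (h.inner_notMem _ ?_ haT i)
  exact fun haA => h.fam.notMem C hC _ ha ((h.flag_mem a).2 haA)

theorem flag_mem_of_inner (h : IsCleanFamily H k U 𝒞 A T) {C} (hC : C ∈ 𝒞) {e : E}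
    {i : Fin (k - 2)} (hi : Sum.inr (e, i) ∈ C) (heA : e ∉ A) {a : H.Flag} (ha : a.1.2 = e) :
    Sum.inl a ∈ C :=
  h.fam.closed C hC _ hi (Sum.inl a) ha fun haU => heA (ha ▸ (h.flag_mem a).1 haU)

theorem flag_mem_of_flag (h : IsCleanFamily H k U 𝒞 A T) (hk : 3 ≤ k) {C} (hC : C ∈ 𝒞)
    {a b : H.Flag} (ha : Sum.inl a ∈ C) (haT : a.1.2 ∉ T) (hab : b.1.2 = a.1.2) :
    Sum.inl b ∈ C :=
  h.flag_mem_of_inner hC (h.inner_mem_of_flag hC ha haT ⟨0, by omega⟩)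
    (fun haA => h.fam.notMem C hC _ ha ((h.flag_mem a).2 haA)) hab

theorem flag_mem_of_full (h : IsCleanFamily H k U 𝒞 A T) (hk : 3 ≤ k) {C} (hC : C ∈ 𝒞)
    {e : E} (heA : e ∉ A) (heT : e ∉ T) {u : V} (hu : u ∈ H.inc e) (hf : Full U C u)
    (a : H.Flag) (ha : a.1.2 = e) : Sum.inl a ∈ C := by
  have := hf ⟨(u, e), hu⟩ rfl fun hU => heA ((h.flag_mem _).1 hU)
  exact h.flag_mem_of_flag hk hC this heT ha

theorem full_of_full (h : IsCleanFamily H k U 𝒞 A T) (hk : 3 ≤ k) {C} (hC : C ∈ 𝒞)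
    {e : E} (heA : e ∉ A) (heT : e ∉ T) {u w : V} (hu : u ∈ H.inc e) (hw : w ∈ H.inc e)
    (hf : Full U C u) : Full U C w :=
  h.full_of_mem hC (a := ⟨(w, e), hw⟩) (h.flag_mem_of_full hk hC heA heT hu hf _ rfl)

/-- A member of the family without inner vertices of edges of `A` contains a flag of an edge
of `T`. -/
theorem exists_flag_mem (h : IsCleanFamily H k U 𝒞 A T) (hk : 3 ≤ k) (hunif : H.IsUniform k) {C}
    (hC : C ∈ 𝒞) (hCA : ∀ e ∈ A, ∀ i, Sum.inr (e, i) ∉ C) :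
    ∃ a : H.Flag, a.1.2 ∈ T ∧ Sum.inl a ∈ C := by
  by_contra hcon
  push Not at hcon
  -- Without flags of `T`, the set `C` meets only edges outside `A ∪ T`, and contains each edge it
  -- meets completely: `k` flags and `k - 2` inner vertices, an even number.
  refine Nat.not_even_iff_odd.2 (h.fam.odd C hC) ?_
  rw [Finset.card_eq_sum_card_fiberwise (f := flagGraphEdge H k) (t := Finset.univ)
    (fun x _ => Finset.mem_coe.2 (Finset.mem_univ _))]
  refine Finset.even_sum _ fun e _ => ?_
  rcases (C.filter fun x => flagGraphEdge H k x = e).eq_empty_or_nonempty with he | ⟨x, hx⟩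
  · rw [he]
    exact ⟨0, rfl⟩
  · obtain ⟨hxC, hxe⟩ := Finset.mem_filter.1 hx
    have hfl : ∃ a : H.Flag, a.1.2 = e ∧ Sum.inl a ∈ C := by
      rcases x with a | ⟨e', i⟩
      · exact ⟨a, hxe, hxC⟩
      · have hxe : e' = e := hxe
        subst hxe
        have hne : (H.inc e').Nonempty := Finset.card_pos.1 (by rw [hunif]; omega)
        obtain ⟨v, hv⟩ := hne
        exact ⟨⟨(v, e'), hv⟩, rfl, h.flag_mem_of_inner hC hxC (fun hA => hCA _ hA i hxC) rfl⟩
    obtain ⟨a, rfl, ha⟩ := hfl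
    have haT : a.1.2 ∉ T := fun haT => hcon a haT ha
    have : (C.filter fun x => flagGraphEdge H k x = a.1.2) =
        Finset.univ.filter fun x => flagGraphEdge H k x = a.1.2 := by
      ext y
      simp only [Finset.mem_filter, Finset.mem_univ, true_and, and_iff_right_iff_imp]
      rcases y with b | ⟨e', i⟩
      · exact fun hb => h.flag_mem_of_flag hk hC ha haT hb
      · intro he'
        have he' : e' = a.1.2 := he'
        exact he' ▸ h.inner_mem_of_flag hC ha haT i
    rw [this]
    exact even_card_flagGraphEdge_fiber (by omega) hunif _

/-- `Full` turns membership of flags in `C` into a property of vertices, which can be propagated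
along edges. Once it reaches the vertex of `a'`, the flag `a'` lies in both sets. -/
theorem eq_of_full_iff (h : IsCleanFamily H k U 𝒞 A T) {C C'} (hC : C ∈ 𝒞) (hC' : C' ∈ 𝒞)
    {a a' : H.Flag} (ha : Sum.inl a ∈ C) (ha' : Sum.inl a' ∈ C')
    (hiff : Full U C a.1.1 → Full U C a'.1.1) : C = C' :=
  h.fam.disj C hC C' hC' _
    (hiff (h.full_of_mem hC ha) a' rfl (h.fam.notMem C' hC' _ ha')) ha'

/-- At most `|A|(k-2)` members contain an inner vertex of an edge of `A`. Discarding them reduces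
the bound `k|A|` from the flags of `A` to `2|A|`. -/
theorem card_lt_of_bound (h : IsCleanFamily H k U 𝒞 A T) (hk : 3 ≤ k) (hunif : H.IsUniform k)
    (hlt : U.card < 𝒞.card) : ∃ 𝒟 ⊆ 𝒞, A.card * 2 + T.card * (k - 2) < 𝒟.card ∧
      ∀ C ∈ 𝒟, ∃ a : H.Flag, a.1.2 ∈ T ∧ Sum.inl a ∈ C := by
  classical
  have h1 : (𝒞.filter fun C => ∃ e ∈ A, ∃ i, Sum.inr (e, i) ∈ C).card ≤ A.card * (k - 2) := by
    have : ∀ C ∈ 𝒞.filter (fun C => ∃ e ∈ A, ∃ i, Sum.inr (e, i) ∈ C),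
        ∃ p ∈ A ×ˢ (Finset.univ : Finset (Fin (k - 2))), Sum.inr p ∈ C := by
      intro C hC
      obtain ⟨hC, e, he, i, hi⟩ := Finset.mem_filter.1 hC
      exact ⟨(e, i), by simpa using he, hi⟩
    have := Finset.card_le_card_of_forall_subsingleton _ this fun p _ C hC D hD =>
      h.fam.disj C (Finset.mem_filter.1 hC.1).1 D (Finset.mem_filter.1 hD.1).1 _ hC.2 hD.2
    simpa using this
  refine ⟨𝒞.filter fun C => ¬ ∃ e ∈ A, ∃ i, Sum.inr (e, i) ∈ C, Finset.filter_subset _ _, ?_, ?_⟩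
  · have h2 := h.card_barrier hunif
    have h3 := Finset.card_filter_add_card_filter_not (s := 𝒞)
      (fun C => ∃ e ∈ A, ∃ i, Sum.inr (e, i) ∈ C)
    have h4 : A.card * k = A.card * (k - 2) + A.card * 2 := by
      rw [← mul_add]
      congr 1
      omega
    omega
  · intro C hC
    obtain ⟨hC, hCA⟩ := Finset.mem_filter.1 hC
    push Not at hCA
    exact h.exists_flag_mem hk hunif hC hCA

end IsCleanFamily

/-- With `d = ⌊(c+3)/k⌋`, one has `c + 4 ≤ k(d+1)`. If `t = a + 1`, parity improves `2d ≤ 2a + 1` to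
`d ≤ a`. If `t = a + 1 + δ` with `δ ≥ 1`, the doubled inequality has slack `(k-4)(δ-1)`, which is
where `k ≥ 4` is needed. -/
theorem barrier_arithmetic {k a t c : ℕ} (hk : 4 ≤ k) (hlt : a < t)
    (h : 2 * ((c + 3) / k) ≤ a + t) : a + t = 1 ∨ c ≤ a * 2 + t * (k - 2) := by
  obtain ⟨d, hd⟩ : ∃ d, d = (c + 3) / k := ⟨_, rfl⟩
  rw [← hd] at h
  have h1 : c + 3 < k * (d + 1) := by
    rw [hd]
    exact Nat.lt_mul_div_succ _ (by omega)
  obtain ⟨l, rfl⟩ : ∃ l, k = l + 4 := ⟨k - 4, by omega⟩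
  obtain ⟨δ, rfl⟩ : ∃ δ, t = a + 1 + δ := ⟨t - a - 1, by omega⟩
  right
  have hl : l + 4 - 2 = l + 2 := by omega
  rw [hl]
  rcases Nat.eq_zero_or_pos δ with rfl | hδ
  · have hda : d ≤ a := by omega
    nlinarith
  · obtain ⟨δ, rfl⟩ : ∃ ε, δ = ε + 1 := ⟨δ - 1, by omega⟩
    nlinarith

end Barrier

/-- If `H` has no cut edges and deleting any set `X` of at least two edges leaves few components
(the classes `κ X`), then the auxiliary graph has a perfect matching. -/
theorem exists_isPerfectMatching_flagGraph {V E : Type*} [Fintype V] [Fintype E]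
    {H : MultiHypergraph V E} {k : ℕ} (hk : 4 ≤ k) (hunif : H.IsUniform k)
    (hcut : ∀ e : E, ¬ H.IsCutEdge e) {κ : Finset E → Type*} [∀ X, Finite (κ X)]
    (comp : ∀ X, V → κ X)
    (hcomp : ∀ (X : Finset E) (R : V → Prop),
      (∀ e, e ∉ X → ∀ x ∈ H.inc e, ∀ y ∈ H.inc e, R x → R y) →
      ∀ u w, comp X u = comp X w → R u → R w)
    (hX : ∀ X : Finset E, 2 ≤ X.card → 2 * ((Nat.card (κ X) + 3) / k) ≤ X.card) :
    ∃ M : (H.flagGraph k).Subgraph, M.IsPerfectMatching := by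
  classical
  by_contra hno
  push Not at hno
  have hk3 : 3 ≤ k := by omega
  obtain ⟨U, 𝒞, A, T, h, hlt⟩ := exists_isCleanFamily hk3 hunif hno
  obtain ⟨𝒟, h𝒟, hcard, hflag⟩ := h.card_lt_of_bound hk3 hunif hlt
  have : Nonempty H.Flag := by
    obtain ⟨C, hC⟩ := Finset.card_pos.1 ((Nat.zero_le _).trans_lt hcard)
    exact ⟨(hflag C hC).choose⟩
  choose! τ hτT hτ using hflag
  -- Disjoint members have distinct chosen flags, and `T` has only `k|T|` flags. Together with
  -- `hcard` this forces `|A| < |T|`.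
  have hT : 𝒟.card ≤ T.card * k := by
    rw [← card_flags_of_edges hunif T]
    refine Finset.card_le_card_of_injOn τ (fun C hC => by simpa using hτT C hC) ?_
    exact fun C hC D hD hCD => h.fam.disj C (h𝒟 hC) D (h𝒟 hD) _ (hτ C hC) (hCD ▸ hτ D hD)
  have hTk : T.card * k = T.card * (k - 2) + T.card * 2 := by
    rw [← mul_add]
    congr 1
    omega
  have hAT : A.card < T.card := by omega
  by_cases h1 : A.card + T.card = 1
  · have hA : A = ∅ := Finset.card_eq_zero.1 (by omega)
    obtain ⟨e, rfl⟩ := Finset.card_eq_one.1 (show T.card = 1 by omega)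
    -- Since `e` is not a cut edge, fullness passes between any two of its vertices, so only one
    -- member can contain a flag of `e`; yet `hcard` requires more than `k - 2`.
    have : 𝒟.card ≤ 1 := by
      refine Finset.card_le_one.2 fun C hC D hD => ?_
      refine h.eq_of_full_iff (h𝒟 hC) (h𝒟 hD) (hτ C hC) (hτ D hD) ?_
      refine (iff_of_not_isCutEdge (hcut e) (R := IsCleanFamily.Full U C) ?_ ?_ ?_).1
      · intro f hf x hx y hy
        exact h.full_of_full hk3 (h𝒟 hC) (by simp [hA]) (by simpa using hf) hx hy
      · have := (τ C).2
        rwa [Finset.mem_singleton.1 (hτT C hC)] at this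
      · have := (τ D).2
        rwa [Finset.mem_singleton.1 (hτT D hD)] at this
    simp only [Finset.card_singleton] at hcard
    omega
  · have hXc := hX (A ∪ T) (by rw [Finset.card_union_of_disjoint h.disj]; omega)
    rw [Finset.card_union_of_disjoint h.disj] at hXc
    have hle := (barrier_arithmetic hk hAT hXc).resolve_left h1
    have : 𝒟.card ≤ Nat.card (κ (A ∪ T)) := by
      rw [← Fintype.card_coe, ← Nat.card_eq_fintype_card]
      refine Nat.card_le_card_of_injective (fun C : 𝒟 => comp (A ∪ T) (τ C).1.1) ?_
      rintro ⟨C, hC⟩ ⟨D, hD⟩ hCD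
      refine Subtype.ext (h.eq_of_full_iff (h𝒟 hC) (h𝒟 hD) (hτ C hC) (hτ D hD) ?_)
      refine hcomp (A ∪ T) _ (fun e he x hx y hy => ?_) _ _ hCD
      rw [Finset.mem_union, not_or] at he
      exact h.full_of_full hk3 (h𝒟 hC) he.1 he.2 hx hy
    omega

end MultiHypergraph

/-! ### Perfect matchings, even selections and factors -/

namespace MultiHypergraph

/-- A set of flags containing exactly two flags of every edge and an even number of flags of every
vertex. -/
structure IsEvenSelection {V E : Type*} [DecidableEq V] [DecidableEq E] (H : MultiHypergraph V E)
    (S : Finset H.Flag) : Prop where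
  two : ∀ e, (S.filter fun a => a.1.2 = e).card = 2
  even : ∀ v, Even (S.filter fun a => a.1.1 = v).card

theorem exists_isEvenSelection_of_isPerfectMatching {V E : Type*} [Fintype V] [Fintype E]
    [DecidableEq V] [DecidableEq E] {H : MultiHypergraph V E} {k : ℕ} (hk : 2 ≤ k)
    (hunif : H.IsUniform k) {M : (H.flagGraph k).Subgraph} (hM : M.IsPerfectMatching) :
    ∃ S, H.IsEvenSelection S := by
  classical
  rw [SimpleGraph.Subgraph.isPerfectMatching_iff] at hM
  choose μ hμ hμ' using hM
  -- A flag is selected when its partner is a flag; the other flags of `e` correspond to its `k - 2`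
  -- inner vertices.
  refine ⟨Finset.univ.filter fun a => ∃ b, M.Adj (Sum.inl a) (Sum.inl b), ?_, ?_⟩
  · intro e
    have h1 := Finset.card_filter_add_card_filter_not
      (s := Finset.univ.filter fun a : H.Flag => a.1.2 = e)
      (fun a => ∃ b, M.Adj (Sum.inl a) (Sum.inl b))
    rw [card_flags_of_edge, hunif e, Finset.filter_filter, Finset.filter_filter] at h1
    have h2 : (Finset.univ.filter fun a : H.Flag => a.1.2 = e ∧
        ¬ ∃ b, M.Adj (Sum.inl a) (Sum.inl b)).card = k - 2 := by
      refine Eq.trans ?_ (show (Finset.univ : Finset (Fin (k - 2))).card = k - 2 by simp)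
      have hpart : ∀ i : Fin (k - 2), ∃ a : H.Flag, a.1.2 = e ∧
          M.Adj (Sum.inr (e, i)) (Sum.inl a) := by
        intro i
        have h := hμ (Sum.inr (e, i))
        have h' := M.adj_sub h
        rcases hx : μ (Sum.inr (e, i)) with a | p
        · rw [hx] at h h'
          exact ⟨a, h', h⟩
        · rw [hx] at h'
          exact h'.elim
      choose ν hν hν' using hpart
      symm
      refine Finset.card_bij (fun i _ => ν i) ?_ ?_ ?_
      · intro i _
        rw [Finset.mem_filter]
        refine ⟨Finset.mem_univ _, hν i, ?_⟩
        rintro ⟨b, hb⟩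
        have := (hμ' _ _ hb).trans (hμ' _ _ (hν' i).symm).symm
        cases this
      · intro i _ j _ hij
        have hj := hν' j
        rw [← show ν i = ν j from hij] at hj
        have := (hμ' _ _ (hν' i).symm).trans (hμ' _ _ hj.symm).symm
        cases this
        rfl
      · intro a ha
        obtain ⟨-, hae, ha⟩ := Finset.mem_filter.1 ha
        have h := hμ (Sum.inl a)
        have h' := M.adj_sub h
        rcases hx : μ (Sum.inl a) with b | ⟨e', i⟩
        · rw [hx] at h
          exact absurd ⟨b, h⟩ ha
        · rw [hx] at h h'
          have he' : a.1.2 = e' := h'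
          obtain rfl : e' = e := he'.symm.trans hae
          refine ⟨i, Finset.mem_univ _, ?_⟩
          have := (hμ' _ _ (hν' i)).trans (hμ' _ _ h.symm).symm
          cases this
          rfl
    rw [Finset.filter_filter]
    simp only [and_comm (a := ∃ _, _)]
    omega
  · intro v
    rw [Finset.filter_filter, ← ZMod.natCast_eq_zero_iff_even, Finset.card_eq_sum_ones,
      Nat.cast_sum]
    have hpart : ∀ a : H.Flag, ∀ h : ∃ b, M.Adj (Sum.inl a) (Sum.inl b),
        M.Adj (Sum.inl a) (Sum.inl h.choose) := fun a h => h.choose_spec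
    -- Matching partners give a fixed-point-free involution on the selected flags at `v`, so their
    -- number vanishes modulo 2.
    refine Finset.sum_involution (fun a ha => (Finset.mem_filter.1 ha).2.1.choose) ?_ ?_ ?_ ?_
    · intro a ha
      decide
    · intro a ha _ hfix
      have := M.adj_sub (hpart a (Finset.mem_filter.1 ha).2.1)
      rw [hfix] at this
      exact (H.flagGraph k).irrefl this
    · intro a ha
      have h := hpart a (Finset.mem_filter.1 ha).2.1
      have h' : a.1.1 = _ := (M.adj_sub h).2
      exact Finset.mem_filter.2 ⟨Finset.mem_univ _, ⟨a, h.symm⟩,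
        h'.symm.trans (Finset.mem_filter.1 ha).2.2⟩
    · intro a ha
      have h := hpart a (Finset.mem_filter.1 ha).2.1
      have := (hμ' _ _ (hpart _ ⟨a, h.symm⟩)).trans (hμ' _ _ h.symm).symm
      exact Sum.inl_injective this

section Factor

variable {V E : Type*} {H : MultiHypergraph V E} {N : ℕ}
  {F : Graph (V ⊕ E) (H.Flag ⊕ (V ⊕ E) × Fin N)}

theorem isLink_inl_iff {a : H.Flag} {x y : V ⊕ E} :
    (H.incidenceGraph.appendLoops (Set.range Sum.inl) N).IsLink (Sum.inl a) x y ↔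
      (x = Sum.inl a.1.1 ∧ y = Sum.inr a.1.2) ∨ (x = Sum.inr a.1.2 ∧ y = Sum.inl a.1.1) :=
  Iff.rfl

theorem isLink_inr_iff {z : V ⊕ E} {i : Fin N} {x y : V ⊕ E} :
    (H.incidenceGraph.appendLoops (Set.range Sum.inl) N).IsLink (Sum.inr (z, i)) x y ↔
      z ∈ Set.range (Sum.inl : V → V ⊕ E) ∧ x = z ∧ y = z :=
  ⟨fun h => h.2, fun h => ⟨Set.mem_univ _, h⟩⟩

theorem inc_inl_iff (hF : F ≤ H.incidenceGraph.appendLoops (Set.range Sum.inl) N) {a : H.Flag}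
    {x : V ⊕ E} : F.Inc (Sum.inl a) x ↔
      Sum.inl a ∈ F.edgeSet ∧ (x = Sum.inl a.1.1 ∨ x = Sum.inr a.1.2) := by
  constructor
  · rintro ⟨y, h⟩
    refine ⟨h.edge_mem, ?_⟩
    rcases isLink_inl_iff.1 (h.mono hF) with h | h
    exacts [Or.inl h.1, Or.inr h.1]
  · rintro ⟨h, hx⟩
    rw [Graph.IsSubgraph.inc_congr hF h]
    rcases hx with hx | hx
    exacts [⟨_, isLink_inl_iff.2 (Or.inl ⟨hx, rfl⟩)⟩, ⟨_, isLink_inl_iff.2 (Or.inr ⟨hx, rfl⟩)⟩]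

theorem not_isLoopAt_inl (hF : F ≤ H.incidenceGraph.appendLoops (Set.range Sum.inl) N)
    {a : H.Flag} {x : V ⊕ E} : ¬ F.IsLoopAt (Sum.inl a) x := by
  intro h
  rcases isLink_inl_iff.1 (Graph.IsLink.mono hF h) with ⟨h, h'⟩ | ⟨h, h'⟩ <;>
  · rw [h] at h'
    cases h'

theorem isLoopAt_inr_iff (hF : F ≤ H.incidenceGraph.appendLoops (Set.range Sum.inl) N) {z : V ⊕ E}
    {i : Fin N} {x : V ⊕ E} : F.IsLoopAt (Sum.inr (z, i)) x ↔
      Sum.inr (z, i) ∈ F.edgeSet ∧ x = z := by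
  constructor
  · intro h
    exact ⟨h.edge_mem, (isLink_inr_iff.1 (Graph.IsLink.mono hF h)).2.1⟩
  · rintro ⟨h, rfl⟩
    rw [Graph.IsSubgraph.isLoopAt_congr hF h]
    obtain ⟨y, w, hyw⟩ := F.exists_isLink_of_mem_edgeSet h
    exact isLink_inr_iff.2 ⟨(isLink_inr_iff.1 (hyw.mono hF)).1, rfl, rfl⟩

theorem inc_inr_iff (hF : F ≤ H.incidenceGraph.appendLoops (Set.range Sum.inl) N) {z : V ⊕ E}
    {i : Fin N} {x : V ⊕ E} : F.Inc (Sum.inr (z, i)) x ↔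
      Sum.inr (z, i) ∈ F.edgeSet ∧ x = z := by
  constructor
  · rintro ⟨y, h⟩
    exact ⟨h.edge_mem, (isLink_inr_iff.1 (h.mono hF)).2.1⟩
  · exact fun h => ⟨x, (isLoopAt_inr_iff hF).2 h⟩

theorem eq_inl_of_loop_mem_edgeSet
    (hF : F ≤ H.incidenceGraph.appendLoops (Set.range Sum.inl) N) {z : V ⊕ E} {i : Fin N}
    (h : Sum.inr (z, i) ∈ F.edgeSet) : ∃ v, Sum.inl v = z := by
  obtain ⟨y, w, hyw⟩ := Graph.exists_isLink_of_mem_edgeSet h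
  exact (isLink_inr_iff.1 (hyw.mono hF)).1

theorem degree_inr (hF : F ≤ H.incidenceGraph.appendLoops (Set.range Sum.inl) N) (e : E) :
    F.degree (Sum.inr e) = {a : H.Flag | Sum.inl a ∈ F.edgeSet ∧ a.1.2 = e}.ncard := by
  have h1 : F.incidenceSet (Sum.inr e) =
      Sum.inl '' {a : H.Flag | Sum.inl a ∈ F.edgeSet ∧ a.1.2 = e} := by
    ext (a | ⟨z, i⟩)
    · simp [inc_inl_iff hF, eq_comm]
    · simp only [Graph.mem_incidenceSet, inc_inr_iff hF, Set.mem_image, reduceCtorEq, and_false,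
        exists_false, iff_false, not_and]
      rintro h rfl
      obtain ⟨v, hv⟩ := eq_inl_of_loop_mem_edgeSet hF h
      cases hv
  have h2 : F.loopSet (Sum.inr e) = ∅ := by
    ext (a | ⟨z, i⟩)
    · simp [not_isLoopAt_inl hF]
    · simp only [Graph.mem_loopSet, isLoopAt_inr_iff hF, Set.mem_empty_iff_false, iff_false,
        not_and]
      rintro h rfl
      obtain ⟨v, hv⟩ := eq_inl_of_loop_mem_edgeSet hF h
      cases hv
  rw [Graph.degree, h1, h2, Set.ncard_empty, Set.ncard_image_of_injective _ Sum.inl_injective,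
    add_zero]

theorem degree_inl [Finite V] [Finite E]
    (hF : F ≤ H.incidenceGraph.appendLoops (Set.range Sum.inl) N) (v : V) :
    F.degree (Sum.inl v) = {a : H.Flag | Sum.inl a ∈ F.edgeSet ∧ a.1.1 = v}.ncard +
      2 * {i : Fin N | Sum.inr (Sum.inl v, i) ∈ F.edgeSet}.ncard := by
  have hinj : Function.Injective
      (fun i : Fin N => (Sum.inr (Sum.inl v, i) : H.Flag ⊕ (V ⊕ E) × Fin N)) := by
    intro i j hij
    simpa using hij
  have h2 : F.loopSet (Sum.inl v) =
      (fun i => Sum.inr (Sum.inl v, i)) '' {i : Fin N | Sum.inr (Sum.inl v, i) ∈ F.edgeSet} := by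
    ext (a | ⟨z, i⟩)
    · simp [not_isLoopAt_inl hF]
    · simp only [Graph.mem_loopSet, isLoopAt_inr_iff hF, Set.mem_image, Set.mem_ofPred_eq,
        Sum.inr.injEq, Prod.mk.injEq]
      constructor
      · rintro ⟨h, rfl⟩
        exact ⟨i, h, rfl, rfl⟩
      · rintro ⟨j, h, rfl, rfl⟩
        exact ⟨h, rfl⟩
  -- A loop lies in the incidence set and again in the loop set, which gives the factor 2.
  have h1 : F.incidenceSet (Sum.inl v) =
      Sum.inl '' {a : H.Flag | Sum.inl a ∈ F.edgeSet ∧ a.1.1 = v} ∪ F.loopSet (Sum.inl v) := by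
    ext (a | ⟨z, i⟩)
    · simp [inc_inl_iff hF, not_isLoopAt_inl hF, eq_comm]
    · simp [inc_inr_iff hF, isLoopAt_inr_iff hF]
  have hd : Disjoint (Sum.inl '' {a : H.Flag | Sum.inl a ∈ F.edgeSet ∧ a.1.1 = v})
      (F.loopSet (Sum.inl v)) := by
    rw [h2, Set.disjoint_left]
    rintro _ ⟨a, -, rfl⟩ ⟨i, -, h⟩
    cases h
  rw [Graph.degree, h1, Set.ncard_union_eq hd (Set.toFinite _) (Set.toFinite _),
    Set.ncard_image_of_injective _ Sum.inl_injective, h2, Set.ncard_image_of_injective _ hinj]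
  ring

theorem exists_isFactor [Fintype V] [Fintype E] [DecidableEq V] [DecidableEq E] {S : Finset H.Flag}
    (hS : H.IsEvenSelection S) {r : ℕ} {f : V ⊕ E → ℕ}
    (hr : ∀ v, (S.filter fun a => a.1.1 = v).card ≤ 2 * r)
    (hfv : ∀ v : V, f (Sum.inl v) = 2 * r) (hfe : ∀ e : E, f (Sum.inr e) = 2) :
    ∃ F, (H.incidenceGraph.appendLoops (Set.range Sum.inl) (2 * r)).IsFactor f f F := by
  set G := H.incidenceGraph.appendLoops (Set.range Sum.inl) (2 * r) with hG
  -- If `v` has `d` selected flags, `r - d/2` loops raise its degree to `2r`; `d` is even and at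
  -- most `2r`.
  let B : Set (H.Flag ⊕ (V ⊕ E) × Fin (2 * r)) := Sum.inl '' (S : Set H.Flag) ∪
    {b | ∃ v i, b = Sum.inr (Sum.inl v, i) ∧
      (i : ℕ) < r - (S.filter fun a => a.1.1 = v).card / 2}
  have hle : G.restrict B ≤ G := Graph.restrict_le
  have hinl : ∀ a : H.Flag, Sum.inl a ∈ (G.restrict B).edgeSet ↔ a ∈ S := by
    intro a
    have : Sum.inl a ∈ G.edgeSet :=
      (Graph.edge_mem_iff_exists_isLink ..).2 ⟨_, _, isLink_inl_iff.2 (Or.inl ⟨rfl, rfl⟩)⟩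
    simp [this, B]
  have hinr : ∀ (v : V) (i : Fin (2 * r)), Sum.inr (Sum.inl v, i) ∈ (G.restrict B).edgeSet ↔
      (i : ℕ) < r - (S.filter fun a => a.1.1 = v).card / 2 := by
    intro v i
    have : Sum.inr (Sum.inl v, i) ∈ G.edgeSet :=
      (Graph.edge_mem_iff_exists_isLink ..).2 ⟨_, _, isLink_inr_iff.2 ⟨⟨v, rfl⟩, rfl, rfl⟩⟩
    simp [this, B]
  refine ⟨G.restrict B, ⟨hle, rfl⟩, fun x _ => ?_⟩
  suffices h : (G.restrict B).degree x = f x by rw [h]; exact ⟨le_rfl, le_rfl⟩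
  rcases x with v | e
  · have h1 : {a : H.Flag | Sum.inl a ∈ (G.restrict B).edgeSet ∧ a.1.1 = v} =
        ↑(S.filter fun a => a.1.1 = v) := by
      ext a
      simp only [hinl, Set.mem_ofPred_eq, Finset.coe_filter]
    have h2 : {i : Fin (2 * r) | Sum.inr (Sum.inl v, i) ∈ (G.restrict B).edgeSet}.ncard =
        r - (S.filter fun a => a.1.1 = v).card / 2 := by
      simp only [hinr]
      rw [Set.ncard_eq_toFinset_card', Set.toFinset_ofPred, Fin.card_filter_val_lt]
      omega
    rw [degree_inl hle, h1, h2, Set.ncard_coe_finset, hfv]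
    obtain ⟨d, hd⟩ := hS.even v
    have := hr v
    omega
  · have h1 : {a : H.Flag | Sum.inl a ∈ (G.restrict B).edgeSet ∧ a.1.2 = e} =
        ↑(S.filter fun a => a.1.2 = e) := by
      ext a
      simp only [hinl, Set.mem_ofPred_eq, Finset.coe_filter]
    rw [degree_inr hle, h1, Set.ncard_coe_finset, hfe, hS.two]

theorem isEvenSelection_of_isFactor [Fintype V] [Fintype E] [DecidableEq V] [DecidableEq E] {r : ℕ}
    {f : V ⊕ E → ℕ} (hfv : ∀ v : V, f (Sum.inl v) = 2 * r) (hfe : ∀ e : E, f (Sum.inr e) = 2)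
    (hF : (H.incidenceGraph.appendLoops (Set.range Sum.inl) N).IsFactor f f F) {S : Finset H.Flag}
    (hS : ∀ a, a ∈ S ↔ Sum.inl a ∈ F.edgeSet) : H.IsEvenSelection S := by
  have hle := hF.1.le
  have hdeg : ∀ x, F.degree x = f x := fun x =>
    le_antisymm (hF.2 x (Set.mem_univ _)).2 (hF.2 x (Set.mem_univ _)).1
  refine ⟨fun e => ?_, fun v => ?_⟩
  · have h1 : {a : H.Flag | Sum.inl a ∈ F.edgeSet ∧ a.1.2 = e} =
        ↑(S.filter fun a => a.1.2 = e) := by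
      ext a
      simp only [← hS, Set.mem_ofPred_eq, Finset.coe_filter]
    have := hdeg (Sum.inr e)
    rwa [degree_inr hle, h1, Set.ncard_coe_finset, hfe] at this
  · have h1 : {a : H.Flag | Sum.inl a ∈ F.edgeSet ∧ a.1.1 = v} =
        ↑(S.filter fun a => a.1.1 = v) := by
      ext a
      simp only [← hS, Set.mem_ofPred_eq, Finset.coe_filter]
    have := hdeg (Sum.inl v)
    rw [degree_inl hle, h1, Set.ncard_coe_finset, hfv] at this
    rw [Nat.even_iff]
    omega

end Factor

end MultiHypergraph

/-! ### Closed trails and Euler families -/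

namespace MultiHypergraph

namespace Walk

variable {V E : Type*} {H : MultiHypergraph V E}

/-- Concatenation of walks. -/
def append {u v w : V} : H.Walk u v → H.Walk v w → H.Walk u w
  | nil _, q => q
  | cons e hne hu hv p, q => cons e hne hu hv (p.append q)

theorem edges_append {u v w : V} (p : H.Walk u v) (q : H.Walk v w) :
    (p.append q).edges = p.edges ++ q.edges := by
  induction p with
  | nil v => rfl
  | cons e hne hu hv p ih => simp [append, edges, ih]

theorem anchorFlags_append {u v w : V} (p : H.Walk u v) (q : H.Walk v w) :
    (p.append q).anchorFlags = p.anchorFlags ++ q.anchorFlags := by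
  induction p with
  | nil v => rfl
  | cons e hne hu hv p ih => simp [append, anchorFlags, ih]

theorem exists_eq_append {u w x : V} (p : H.Walk u w) (hx : x ∈ p.anchors) :
    ∃ (q : H.Walk u x) (q' : H.Walk x w), p = q.append q' := by
  induction p with
  | nil v =>
    obtain rfl : x = v := by simpa [anchors] using hx
    exact ⟨nil x, nil x, rfl⟩
  | @cons u v w e hne hu hv p ih =>
    rcases List.mem_cons.1 hx with rfl | hx
    · exact ⟨nil x, cons e hne hu hv p, rfl⟩
    · obtain ⟨q, q', rfl⟩ := ih hx
      exact ⟨cons e hne hu hv q, q', rfl⟩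

theorem snd_mem_edges {u w : V} (p : H.Walk u w) {x : V × E} (hx : x ∈ p.anchorFlags) :
    x.2 ∈ p.edges := by
  induction p with
  | nil v => cases hx
  | cons e hne hu hv p ih =>
    simp only [anchorFlags, List.mem_cons] at hx
    rcases hx with rfl | rfl | hx
    · exact List.mem_cons_self
    · exact List.mem_cons_self
    · exact List.mem_cons_of_mem _ (ih hx)

theorem exists_flag_of_mem_anchors {u w x : V} (p : H.Walk u w) (hp : p.IsNontrivial)
    (hx : x ∈ p.anchors) : ∃ e, (x, e) ∈ p.anchorFlags := by
  induction p with
  | nil v => exact absurd rfl hp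
  | @cons u v w e hne hu hv p ih =>
    rcases List.mem_cons.1 hx with rfl | hx
    · exact ⟨e, List.mem_cons_self⟩
    · cases p with
      | nil =>
        obtain rfl : x = v := by simpa [anchors] using hx
        exact ⟨e, by simp [anchorFlags]⟩
      | cons e' hne' hu' hv' p' =>
        obtain ⟨f, hf⟩ := ih (by simp [IsNontrivial, edges]) hx
        exact ⟨f, List.mem_cons_of_mem _ (List.mem_cons_of_mem _ hf)⟩

theorem exists_two_flags_of_mem_edges {u w : V} (p : H.Walk u w) {e : E} (he : e ∈ p.edges) :
    ∃ x y, x ≠ y ∧ (x, e) ∈ p.anchorFlags ∧ (y, e) ∈ p.anchorFlags := by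
  induction p with
  | nil v => cases he
  | @cons u v w f hne hu hv p ih =>
    rcases List.mem_cons.1 he with rfl | he
    · exact ⟨u, v, hne, by simp [anchorFlags], by simp [anchorFlags]⟩
    · obtain ⟨x, y, hxy, hx, hy⟩ := ih he
      exact ⟨x, y, hxy, List.mem_cons_of_mem _ (List.mem_cons_of_mem _ hx),
        List.mem_cons_of_mem _ (List.mem_cons_of_mem _ hy)⟩

theorem IsStrictTrail.nodup_anchorFlags {u w : V} {p : H.Walk u w} (hp : p.IsStrictTrail) :
    p.anchorFlags.Nodup := by
  induction p with
  | nil v => exact List.nodup_nil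
  | cons e hne hu hv p ih =>
    obtain ⟨he, hp⟩ := List.nodup_cons.1 hp
    refine List.nodup_cons.2 ⟨fun h => ?_, List.nodup_cons.2 ⟨fun h => ?_, ih hp⟩⟩
    · rcases List.mem_cons.1 h with h | h
      · exact hne (Prod.ext_iff.1 h).1
      · exact he (p.snd_mem_edges h)
    · exact he (p.snd_mem_edges h)

/-- Each step contributes one flag at each of its two ends, so every inner visit to `x` counts twice
and only the end vertices affect the parity. -/
theorem even_countP_anchorFlags [DecidableEq V] {u w : V} (p : H.Walk u w) (x : V) :
    Even (p.anchorFlags.countP (fun a => a.1 = x) + (if u = x then 1 else 0) +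
      (if w = x then 1 else 0)) := by
  induction p with
  | nil v => split_ifs <;> simp [anchorFlags]
  | cons e hne hu hv p ih =>
    simp only [anchorFlags, List.countP_cons, decide_eq_true_eq]
    rw [Nat.even_iff] at ih ⊢
    omega

end Walk

section Euler

variable {V E : Type*} [DecidableEq V] [DecidableEq E] {H : MultiHypergraph V E}
  {S : Finset (V × E)}

/-- A strict trail all of whose anchor flags lie in `S` and all of whose edges lie in `B`. -/
structure IsTrailIn (S : Finset (V × E)) (B : Finset E) {u w : V} (p : H.Walk u w) : Prop where
  strict : p.IsStrictTrail
  flags : ∀ a ∈ p.anchorFlags, a ∈ S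
  edges : ∀ e ∈ p.edges, e ∈ B

theorem IsTrailIn.mono {B B' : Finset E} (hB : B ⊆ B') {u w : V} {p : H.Walk u w}
    (hp : IsTrailIn S B p) : IsTrailIn S B' p :=
  ⟨hp.strict, hp.flags, fun e he => hB (hp.edges e he)⟩

/-- A trail through an edge uses two distinct flags of it, and `S` contains only two. Hence
traversing every edge already uses every flag of `S`. -/
theorem mem_anchorFlags_of_mem_edges (htwo : ∀ e, (S.filter fun a => a.2 = e).card = 2) {u w : V}
    {p : H.Walk u w} (hp : ∀ a ∈ p.anchorFlags, a ∈ S) {a : V × E} (ha : a ∈ S)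
    (hae : a.2 ∈ p.edges) : a ∈ p.anchorFlags := by
  obtain ⟨x, y, hxy, hx, hy⟩ := p.exists_two_flags_of_mem_edges hae
  have hsub : ({(x, a.2), (y, a.2)} : Finset (V × E)) ⊆ S.filter fun b => b.2 = a.2 := by
    intro b hb
    rw [Finset.mem_insert, Finset.mem_singleton] at hb
    rcases hb with rfl | rfl
    exacts [Finset.mem_filter.2 ⟨hp _ hx, rfl⟩, Finset.mem_filter.2 ⟨hp _ hy, rfl⟩]
  have heq := Finset.eq_of_subset_of_card_le hsub
    (by rw [htwo, Finset.card_pair (fun h => hxy (Prod.ext_iff.1 h).1)])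
  have : a ∈ ({(x, a.2), (y, a.2)} : Finset (V × E)) := by
    rw [heq]
    exact Finset.mem_filter.2 ⟨ha, rfl⟩
  rw [Finset.mem_insert, Finset.mem_singleton] at this
  rcases this with h | h <;> rw [h] <;> assumption

theorem even_card_flags_of_trail (htwo : ∀ e, (S.filter fun a => a.2 = e).card = 2)
    {B : Finset E} {u w : V} {p : H.Walk u w} (hp : IsTrailIn S B p) (x : V) :
    Even ((S.filter fun a => a.1 = x ∧ a.2 ∈ p.edges).card + (if u = x then 1 else 0) +
      (if w = x then 1 else 0)) := by
  have h1 : (S.filter fun a => a.1 = x ∧ a.2 ∈ p.edges) =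
      (p.anchorFlags.filter (fun a => a.1 = x)).toFinset := by
    ext a
    simp only [Finset.mem_filter, List.mem_toFinset, List.mem_filter, decide_eq_true_eq]
    exact ⟨fun h => ⟨mem_anchorFlags_of_mem_edges htwo hp.flags h.1 h.2.2, h.2.1⟩,
      fun h => ⟨hp.flags a h.1, h.2, p.snd_mem_edges h.1⟩⟩
  rw [h1, List.toFinset_card_of_nodup (hp.strict.nodup_anchorFlags.filter _),
    ← List.countP_eq_length_filter]
  exact p.even_countP_anchorFlags x

theorem exists_other_flag (htwo : ∀ e, (S.filter fun a => a.2 = e).card = 2) {x : V} {e : E}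
    (h : (x, e) ∈ S) : ∃ y, y ≠ x ∧ (y, e) ∈ S := by
  obtain ⟨⟨y, f⟩, hy, hne⟩ := Finset.exists_mem_ne (by rw [htwo e]; exact one_lt_two) (x, e)
  obtain ⟨hyS, rfl⟩ := Finset.mem_filter.1 hy
  exact ⟨y, fun h => hne (by rw [h]), hyS⟩

/-- A trail in an even edge set extends to a closed trail. -/
theorem IsTrailIn.exists_closed (hinc : ∀ a ∈ S, a.1 ∈ H.inc a.2)
    (htwo : ∀ e, (S.filter fun a => a.2 = e).card = 2) {B : Finset E}
    (heven : ∀ v, Even (S.filter fun a => a.1 = v ∧ a.2 ∈ B).card) {w : V} :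
    ∀ (n : ℕ) {u : V} (p : H.Walk u w), IsTrailIn S B p → B.card ≤ p.edges.length + n →
      ∃ q : H.Walk w w, IsTrailIn S B q ∧ p.edges.length ≤ q.edges.length := by
  intro n
  -- The number `n` bounds the edges of `B` not yet used.
  induction n with
  | zero =>
    intro u p hp hn
    by_cases huw : u = w
    · subst huw
      exact ⟨p, hp, le_rfl⟩
    exfalso
    have h1 := even_card_flags_of_trail htwo hp u
    have h2 : ∀ e ∈ B, e ∈ p.edges := by
      have := Finset.eq_of_subset_of_card_le (s := p.edges.toFinset) (t := B)
        (fun e he => hp.edges e (List.mem_toFinset.1 he))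
        (by rw [List.toFinset_card_of_nodup hp.strict]; exact hn)
      intro e he
      rwa [← this, List.mem_toFinset] at he
    have h3 : (S.filter fun a => a.1 = u ∧ a.2 ∈ p.edges) =
        S.filter fun a => a.1 = u ∧ a.2 ∈ B := by
      ext a
      simp only [Finset.mem_filter]
      exact ⟨fun h => ⟨h.1, h.2.1, hp.edges _ h.2.2⟩, fun h => ⟨h.1, h.2.1, h2 _ h.2.2⟩⟩
    have := heven u
    rw [h3, if_pos rfl, if_neg (Ne.symm huw)] at h1
    rw [Nat.even_iff] at h1 this
    omega
  | succ n ih =>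
    intro u p hp hn
    by_cases huw : u = w
    · subst huw
      exact ⟨p, hp, le_rfl⟩
    have h1 := even_card_flags_of_trail htwo hp u
    -- An open trail uses an odd number of flags at its start `u`, while `B` has an even number
    -- there, so an unused one remains. The trail is prolonged backwards through it.
    have h2 : ∃ e ∈ B, e ∉ p.edges ∧ (u, e) ∈ S := by
      by_contra hcon
      push Not at hcon
      have h3 : (S.filter fun a => a.1 = u ∧ a.2 ∈ p.edges) =
          S.filter fun a => a.1 = u ∧ a.2 ∈ B := by
        ext ⟨v, e⟩
        simp only [Finset.mem_filter]
        refine ⟨fun h => ⟨h.1, h.2.1, hp.edges _ h.2.2⟩, ?_⟩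
        rintro ⟨h, rfl, h'⟩
        exact ⟨h, rfl, by_contra fun h'' => hcon e h' h'' h⟩
      have := heven u
      rw [h3, if_pos rfl, if_neg (Ne.symm huw)] at h1
      rw [Nat.even_iff] at h1 this
      omega
    obtain ⟨e, heB, hep, heS⟩ := h2
    obtain ⟨y, hyu, hyS⟩ := exists_other_flag htwo heS
    obtain ⟨q, hq, hlen⟩ := ih (Walk.cons e hyu (hinc _ hyS) (hinc _ heS) p)
      ⟨List.nodup_cons.2 ⟨hep, hp.strict⟩, by
        simp only [Walk.anchorFlags, List.mem_cons]
        rintro a (rfl | rfl | ha)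
        exacts [hyS, heS, hp.flags a ha], by
        simp only [Walk.edges, List.mem_cons]
        rintro f (rfl | hf)
        exacts [heB, hp.edges f hf]⟩
      (by simp only [Walk.edges, List.length_cons]; omega)
    simp only [Walk.edges, List.length_cons] at hlen
    exact ⟨q, hq, by omega⟩

theorem exists_closed_trail (hinc : ∀ a ∈ S, a.1 ∈ H.inc a.2)
    (htwo : ∀ e, (S.filter fun a => a.2 = e).card = 2) {B : Finset E}
    (heven : ∀ v, Even (S.filter fun a => a.1 = v ∧ a.2 ∈ B).card) {w : V} {e : E} (he : e ∈ B)
    (hw : (w, e) ∈ S) : ∃ q : H.Walk w w, IsTrailIn S B q ∧ q.IsNontrivial := by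
  obtain ⟨y, hyw, hyS⟩ := exists_other_flag htwo hw
  obtain ⟨q, hq, hlen⟩ := IsTrailIn.exists_closed hinc htwo heven B.card
    (Walk.cons e hyw (hinc _ hyS) (hinc _ hw) (Walk.nil w)) ⟨List.nodup_singleton e, by
      simp only [Walk.anchorFlags, List.mem_cons, List.not_mem_nil, or_false]
      rintro a (rfl | rfl)
      exacts [hyS, hw], by
      simp only [Walk.edges, List.mem_cons, List.not_mem_nil, or_false]
      rintro f rfl
      exact he⟩ (by omega)
  refine ⟨q, hq, fun h => ?_⟩
  rw [h] at hlen
  simp [Walk.edges] at hlen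

theorem even_card_flags_sdiff (htwo : ∀ e, (S.filter fun a => a.2 = e).card = 2) {B : Finset E}
    (heven : ∀ v, Even (S.filter fun a => a.1 = v ∧ a.2 ∈ B).card) {u : V} {p : H.Walk u u}
    (hp : IsTrailIn S B p) (v : V) :
    Even (S.filter fun a => a.1 = v ∧ a.2 ∈ B \ p.edges.toFinset).card := by
  have h1 := even_card_flags_of_trail htwo hp v
  have h2 := heven v
  have h3 : (S.filter fun a => a.1 = v ∧ a.2 ∈ B).card =
      (S.filter fun a => a.1 = v ∧ a.2 ∈ p.edges).card +
      (S.filter fun a => a.1 = v ∧ a.2 ∈ B \ p.edges.toFinset).card := by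
    rw [← Finset.card_union_of_disjoint]
    · congr 1
      ext a
      have := hp.edges a.2
      simp only [Finset.mem_filter, Finset.mem_union, Finset.mem_sdiff, List.mem_toFinset]
      tauto
    · rw [Finset.disjoint_left]
      intro a
      simp only [Finset.mem_filter, Finset.mem_sdiff, List.mem_toFinset]
      tauto
  rw [Nat.even_iff] at *
  split_ifs at h1 <;> omega

/-- In an even edge set, a closed trail extends to one that uses all flags at its anchors. -/
theorem IsTrailIn.exists_saturated (hinc : ∀ a ∈ S, a.1 ∈ H.inc a.2)
    (htwo : ∀ e, (S.filter fun a => a.2 = e).card = 2) {B : Finset E}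
    (heven : ∀ v, Even (S.filter fun a => a.1 = v ∧ a.2 ∈ B).card) :
    ∀ (n : ℕ) {w : V} (p : H.Walk w w), IsTrailIn S B p → p.IsNontrivial →
      B.card ≤ p.edges.length + n →
      ∃ (x : V) (q : H.Walk x x), IsTrailIn S B q ∧ q.IsNontrivial ∧
        ∀ a ∈ S, a.1 ∈ q.anchors → a.2 ∈ B → a.2 ∈ q.edges := by
  intro n
  induction n with
  | zero =>
    intro w p hp hp0 hn
    refine ⟨w, p, hp, hp0, fun a _ _ haB => ?_⟩
    have := Finset.eq_of_subset_of_card_le (s := p.edges.toFinset) (t := B)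
      (fun e he => hp.edges e (List.mem_toFinset.1 he))
      (by rw [List.toFinset_card_of_nodup hp.strict]; exact hn)
    rwa [← this, List.mem_toFinset] at haB
  | succ n ih =>
    intro w p hp hp0 hn
    by_cases hsat : ∀ a ∈ S, a.1 ∈ p.anchors → a.2 ∈ B → a.2 ∈ p.edges
    · exact ⟨w, p, hp, hp0, hsat⟩
    push Not at hsat
    obtain ⟨⟨x, e⟩, haS, hx, heB, hep⟩ := hsat
    -- The unused edges still form an even set, so they contain a closed trail `c` through `x`.
    -- Rotating `p` to start at `x` and prefixing `c` gives a longer closed trail.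
    obtain ⟨c, hc, hc0⟩ := exists_closed_trail hinc htwo (even_card_flags_sdiff htwo heven hp)
      (Finset.mem_sdiff.2 ⟨heB, fun h => hep (List.mem_toFinset.1 h)⟩) haS
    obtain ⟨q, q', rfl⟩ := p.exists_eq_append hx
    have hc1 : 0 < c.edges.length := List.length_pos_iff.2 hc0
    have hcB : ∀ f ∈ c.edges, f ∈ B ∧ f ∉ q.edges ∧ f ∉ q'.edges := by
      intro f hf
      have := hc.edges f hf
      simpa [Walk.edges_append] using this
    have hperm : (q'.edges ++ q.edges).Perm (q.edges ++ q'.edges) := List.perm_append_comm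
    have hstrict : (q.edges ++ q'.edges).Nodup := by
      have := hp.strict
      rwa [Walk.IsStrictTrail, Walk.edges_append] at this
    refine ih (c.append (q'.append q)) ⟨?_, ?_, ?_⟩ ?_ ?_
    · rw [Walk.IsStrictTrail, Walk.edges_append, Walk.edges_append]
      refine List.Nodup.append hc.strict (hperm.nodup_iff.2 hstrict) fun f hf hf' => ?_
      have := hcB f hf
      rw [List.mem_append] at hf'
      tauto
    · intro a ha
      rw [Walk.anchorFlags_append, Walk.anchorFlags_append, List.mem_append, List.mem_append] at ha
      have := hp.flags a
      rw [Walk.anchorFlags_append, List.mem_append] at this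
      have := hc.flags a
      tauto
    · intro f hf
      rw [Walk.edges_append, Walk.edges_append, List.mem_append, List.mem_append] at hf
      have := hp.edges f
      rw [Walk.edges_append, List.mem_append] at this
      have := hcB f
      tauto
    · rw [Walk.IsNontrivial, Walk.edges_append]
      simp [show c.edges ≠ [] from hc0]
    · simp only [Walk.edges_append, List.length_append] at hn ⊢
      omega

/-- An edge set in which every vertex has an even number of chosen flags decomposes into closed
trails that are pairwise edge-disjoint and anchor-disjoint. -/
theorem exists_trail_decomposition (hinc : ∀ a ∈ S, a.1 ∈ H.inc a.2)
    (htwo : ∀ e, (S.filter fun a => a.2 = e).card = 2) :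
    ∀ (n : ℕ) (B : Finset E), B.card ≤ n →
      (∀ v, Even (S.filter fun a => a.1 = v ∧ a.2 ∈ B).card) →
      ∃ 𝓕 : Set (Σ v : V, H.Walk v v), (∀ T ∈ 𝓕, IsTrailIn S B T.2 ∧ T.2.IsNontrivial) ∧
        (∀ T ∈ 𝓕, ∀ T' ∈ 𝓕, T ≠ T' → ∀ e ∈ T.2.edges, e ∉ T'.2.edges) ∧
        (∀ T ∈ 𝓕, ∀ T' ∈ 𝓕, T ≠ T' → ∀ v ∈ T.2.anchors, v ∉ T'.2.anchors) ∧
        ∀ e ∈ B, ∃ T ∈ 𝓕, e ∈ T.2.edges := by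
  intro n
  induction n with
  | zero =>
    intro B hB _
    obtain rfl := Finset.card_eq_zero.1 (Nat.le_zero.1 hB)
    exact ⟨∅, by simp⟩
  | succ n ih =>
    intro B hB heven
    rcases B.eq_empty_or_nonempty with rfl | ⟨e, he⟩
    · exact ⟨∅, by simp⟩
    obtain ⟨⟨w, f⟩, hw⟩ := Finset.card_pos.1 (by rw [htwo e]; exact two_pos)
    obtain ⟨hwS, rfl⟩ := Finset.mem_filter.1 hw
    obtain ⟨p, hp, hp0⟩ := exists_closed_trail hinc htwo heven he hwS
    obtain ⟨x, q, hq, hq0, hsat⟩ :=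
      IsTrailIn.exists_saturated hinc htwo heven B.card p hp hp0 (by omega)
    have hsub : q.edges.toFinset ⊆ B := fun f hf => hq.edges f (List.mem_toFinset.1 hf)
    have hlt : (B \ q.edges.toFinset).card < B.card := by
      refine Finset.card_lt_card (Finset.sdiff_ssubset hsub ?_)
      rwa [List.toFinset_nonempty_iff]
    obtain ⟨𝓕, h1, h2, h3, h4⟩ := ih (B \ q.edges.toFinset) (by omega)
      (even_card_flags_sdiff htwo heven hq)
    have hedge : ∀ T ∈ 𝓕, ∀ f ∈ T.2.edges, f ∉ q.edges := fun T hT f hf hfq =>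
      (Finset.mem_sdiff.1 ((h1 T hT).1.edges f hf)).2 (List.mem_toFinset.2 hfq)
    -- A shared anchor would carry a flag of `T`, whose edge belongs to `q` by saturation, against
    -- edge-disjointness.
    have hanchor : ∀ T ∈ 𝓕, ∀ v ∈ T.2.anchors, v ∉ q.anchors := by
      intro T hT v hv hvq
      obtain ⟨f, hf⟩ := T.2.exists_flag_of_mem_anchors (h1 T hT).2 hv
      have hfT := T.2.snd_mem_edges hf
      exact hedge T hT f hfT (hsat _ ((h1 T hT).1.flags _ hf) hvq
        (Finset.mem_sdiff.1 ((h1 T hT).1.edges f hfT)).1)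
    refine ⟨insert ⟨x, q⟩ 𝓕, ?_, ?_, ?_, ?_⟩
    · rintro T (rfl | hT)
      · exact ⟨hq, hq0⟩
      · exact ⟨(h1 T hT).1.mono Finset.sdiff_subset, (h1 T hT).2⟩
    · rintro T (rfl | hT) T' (rfl | hT') hne f hf hf'
      · exact hne rfl
      · exact hedge T' hT' f hf' hf
      · exact hedge T hT f hf hf'
      · exact h2 T hT T' hT' hne f hf hf'
    · rintro T (rfl | hT) T' (rfl | hT') hne f hf hf'
      · exact hne rfl
      · exact hanchor T' hT' f hf' hf
      · exact hanchor T hT f hf hf'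
      · exact h3 T hT T' hT' hne f hf hf'
    · intro f hf
      by_cases hfq : f ∈ q.edges
      · exact ⟨_, Set.mem_insert _ _, hfq⟩
      · obtain ⟨T, hT, hfT⟩ := h4 f (Finset.mem_sdiff.2 ⟨hf, fun h => hfq (List.mem_toFinset.1 h)⟩)
        exact ⟨T, Set.mem_insert_of_mem _ hT, hfT⟩

theorem IsEvenSelection.exists_isEulerFamily [Fintype E] {S : Finset H.Flag}
    (hS : H.IsEvenSelection S) :
    ∃ 𝓕 : Set (Σ v : V, H.Walk v v), H.IsEulerFamily 𝓕 ∧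
      ∀ a : H.Flag, (∃ T ∈ 𝓕, a.1 ∈ T.2.anchorFlags) ↔ a ∈ S := by
  have hmem : ∀ a : H.Flag, a.1 ∈ S.map (Function.Embedding.subtype _) ↔ a ∈ S := fun a =>
    Finset.mem_map' (Function.Embedding.subtype _)
  have htwo : ∀ e, ((S.map (Function.Embedding.subtype _)).filter fun a => a.2 = e).card = 2 := by
    intro e
    rw [Finset.filter_map, Finset.card_map]
    exact hS.two e
  obtain ⟨𝓕, h1, h2, h3, h4⟩ := exists_trail_decomposition (H := H)
    (S := S.map (Function.Embedding.subtype _)) (by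
      intro a ha
      obtain ⟨b, -, rfl⟩ := Finset.mem_map.1 ha
      exact b.2) htwo _ Finset.univ le_rfl (by
      intro v
      rw [Finset.filter_map, Finset.card_map]
      simpa using hS.even v)
  refine ⟨𝓕, ⟨fun T hT => (h1 T hT).1.strict, fun T hT => (h1 T hT).2, h2, h3,
    fun e => h4 e (Finset.mem_univ e)⟩, fun a => ⟨?_, fun ha => ?_⟩⟩
  · rintro ⟨T, hT, ha⟩
    exact (hmem a).1 ((h1 T hT).1.flags _ ha)
  · obtain ⟨T, hT, haT⟩ := h4 a.1.2 (Finset.mem_univ _)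
    exact ⟨T, hT, mem_anchorFlags_of_mem_edges htwo (h1 T hT).1.flags ((hmem a).2 ha) haT⟩

end Euler

/-- Vertices in the same component of the incidence graph without the edges in `X` share every
property that is constant on all edges outside `X`. -/
theorem of_reachable_deleteVerts {V E : Type*} {H : MultiHypergraph V E} {N : ℕ} {X : Finset E}
    {R : V → Prop} (hR : ∀ e, e ∉ X → ∀ x ∈ H.inc e, ∀ y ∈ H.inc e, R x → R y)
    {u w : ((H.incidenceGraph.appendLoops (Set.range Sum.inl) N).deleteVerts
      (Sum.inr '' (X : Set E))).vertexSet}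
    (h : ((H.incidenceGraph.appendLoops (Set.range Sum.inl) N).deleteVerts
      (Sum.inr '' (X : Set E))).underlying.Reachable u w) :
    Sum.elim R (fun e => ∀ x ∈ H.inc e, R x) u.1 →
      Sum.elim R (fun e => ∀ x ∈ H.inc e, R x) w.1 := by
  -- The property `R` is extended to an e-vertex by asking it of all vertices of the edge. It then
  -- passes along every link: surviving e-vertices are outside `X`, and loops change nothing.
  obtain ⟨p⟩ := h
  induction p with
  | nil => exact id
  | @cons u v w huv p ih =>
    refine fun hu => ih ?_
    obtain ⟨-, b, hb⟩ := huv
    obtain ⟨hb, huX, hvX⟩ := (Graph.deleteVerts_isLink _ _).1 hb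
    rcases b with a | ⟨z, i⟩
    · rcases isLink_inl_iff.1 hb with ⟨h1, h2⟩ | ⟨h1, h2⟩
      · rw [h1] at hu
        rw [h2] at hvX ⊢
        exact fun x hx => hR a.1.2 (fun ha => hvX ⟨_, ha, rfl⟩) _ a.2 x hx hu
      · rw [h1] at hu
        rw [h2]
        exact hu _ a.2
    · obtain ⟨-, h1, h2⟩ := isLink_inr_iff.1 hb
      rwa [h2, ← h1]

end MultiHypergraph

open MultiHypergraph

theorem mainTheorem5 {V E : Type*} [Fintype V] [Fintype E] (H : MultiHypergraph V E)
    (k : ℕ) (hk : 4 ≤ k) (hunif : H.IsUniform k) (hcut : ∀ e : E, ¬ H.IsCutEdge e)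
    (r : ℕ) (hr : r = (Fintype.card E + Fintype.card V) ^ 2)
    (Gstar : Graph (V ⊕ E) (H.Flag ⊕ (V ⊕ E) × Fin (2 * r)))
    (hGstar : Gstar = H.incidenceGraph.appendLoops (Set.range Sum.inl) (2 * r))
    (f : V ⊕ E → ℕ) (hfv : ∀ v : V, f (Sum.inl v) = 2 * r) (hfe : ∀ e : E, f (Sum.inr e) = 2)
    (hX : ∀ X : Finset E, 2 ≤ X.card →
      2 * (((Gstar.deleteVerts (Sum.inr '' (X : Set E))).numComponents + 3) / k) ≤ X.card) :
    (∃ F, Gstar.IsFactor f f F) ∧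
    (∀ F, Gstar.IsFactor f f F →
      ∃ 𝓕 : Set (Σ v : V, H.Walk v v), H.IsEulerFamily 𝓕 ∧
        ∀ a : H.Flag, (∃ T ∈ 𝓕, a.1 ∈ T.2.anchorFlags) ↔ Sum.inl a ∈ F.edgeSet) ∧
    H.IsQuasiEulerian := by
  classical
  subst hGstar
  have hfactor : ∃ F, (H.incidenceGraph.appendLoops (Set.range Sum.inl) (2 * r)).IsFactor f f F := by
    have hmem : ∀ (X : Finset E) (v : V), (Sum.inl v : V ⊕ E) ∈
        ((H.incidenceGraph.appendLoops (Set.range Sum.inl) (2 * r)).deleteVerts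
          (Sum.inr '' (X : Set E))).vertexSet := by
      intro X v
      rw [Graph.vertexSet_deleteVerts]
      exact ⟨Set.mem_univ _, by simp⟩
    obtain ⟨M, hM⟩ := exists_isPerfectMatching_flagGraph hk hunif hcut
      (κ := fun X => ((H.incidenceGraph.appendLoops (Set.range Sum.inl) (2 * r)).deleteVerts
        (Sum.inr '' (X : Set E))).underlying.ConnectedComponent)
      (fun X v => SimpleGraph.connectedComponentMk _ ⟨Sum.inl v, hmem X v⟩)
      (fun X R hR u w huw => of_reachable_deleteVerts hR (SimpleGraph.ConnectedComponent.exact huw))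
      hX
    obtain ⟨S, hS⟩ := exists_isEvenSelection_of_isPerfectMatching (by omega) hunif hM
    refine exists_isFactor hS (fun v => ?_) hfv hfe
    -- A vertex has at most one flag in each edge, so `r ≥ |E|` leaves enough room for the padding
    -- loops.
    have h1 : (S.filter fun a => a.1.1 = v).card ≤ Fintype.card E := by
      refine Finset.card_le_card_of_injOn (fun a => a.1.2) (fun _ _ => Finset.mem_univ _) ?_
      intro a ha b hb hab
      have ha := (Finset.mem_filter.1 ha).2
      have hb := (Finset.mem_filter.1 hb).2
      exact Subtype.ext (Prod.ext (ha.trans hb.symm) hab)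
    have h2 : Fintype.card E + Fintype.card V ≤ r := hr ▸ Nat.le_self_pow two_ne_zero _
    omega
  have hfamily : ∀ F, (H.incidenceGraph.appendLoops (Set.range Sum.inl) (2 * r)).IsFactor f f F →
      ∃ 𝓕 : Set (Σ v : V, H.Walk v v), H.IsEulerFamily 𝓕 ∧
        ∀ a : H.Flag, (∃ T ∈ 𝓕, a.1 ∈ T.2.anchorFlags) ↔ Sum.inl a ∈ F.edgeSet := by
    intro F hF
    have hS : ∀ a : H.Flag, a ∈ Finset.univ.filter (fun a => Sum.inl a ∈ F.edgeSet) ↔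
        Sum.inl a ∈ F.edgeSet := by simp
    obtain ⟨𝓕, h𝓕, hflags⟩ := (isEvenSelection_of_isFactor hfv hfe hF hS).exists_isEulerFamily
    exact ⟨𝓕, h𝓕, fun a => (hflags a).trans (hS a)⟩
  refine ⟨hfactor, hfamily, ?_⟩
  obtain ⟨F, hF⟩ := hfactor
  obtain ⟨𝓕, h𝓕, -⟩ := hfamily F hF
  exact ⟨𝓕, h𝓕⟩
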